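/- **System.** Let $n\ge 0$ and consider, for $x\in[0,1]$, $t\ge 0$, the semilinear system $$u_t=-\lambda^u(x)u_x+f^u(x,u,v),\qquad v_t=\lambda^v(x)v_x+f^v(x,u,v),$$ $$\dot X(t)=f^0(X(t),v(0,t),t),\quad u(0,t)=g^0(X(t),v(0,t),t),\quad v(1,t)=U(t),$$ with $X(t)\in\mathbb R^n$ and initial data $(u,v)(\cdot,0)=w_0\in L^\infty(0,1)^2$, $X(0)=X_0$. Assume that $\lambda^u,\lambda^v$ are measurable, positive and bounded away from zero on $[0,1]$; that $f^u,f^v$ are measurable in $x$ and globally Lipschitz in $(u,v)$ uniformly in $x\in[0,1]$; that $f^0,g^0$ are measurable in $t$ and globally Lipschitz in $(X,v)$ uniformly in $t\ge0$; and that $f^u(x,0,0)=f^v(x,0,0)=0$ for $x\in[0,1]$, $f^0(0,0,t)=0$, $g^0(0,0,t)=0$ for $t\ge0$. Solutions of the PDEs are broad solutions in $L^\infty_{loc}$: they are essentially bounded on $[0,1]\times[0,\tau]$ for every $\tau$, and the integral equations obtained by integrating along characteristic lines hold along almost every characteristic line (this gives traces at each $x\in[0,1]$). Solutions of ODEs are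 Carathéodory solutions. **ODE observer.** Let $h:\mathbb R^n\times\mathbb R\times\mathbb R\times\mathbb R\to\mathbb R^n$ be a finite-time observer for the ODE part, i.e. there is $T_h>0$ such that for every initial time $s\ge0$, every $v\in L^\infty(s,\infty)$, every solution $X$ on $[s,\infty)$ of $\dot X=f^0(X,v(t),t)$ and every solution $\hat X$ on $[s,\infty)$ (with any initial value) of $\dot{\hat X}=h(\hat X,\,g^0(X(t),v(t),t),\,v(t),\,t)$, one has $\hat X(t)=X(t)$ for all $t\ge s+T_h$. **Past state.** Put $\check\tau^u(t;x)=t-\int_x^1\frac{d\xi}{\lambda^u(\xi)}$, $\check w(x,t)=(\check u,\check v)(x,t)=(u,v)(x,\check\tau^u(t;x))$ and $\check X(t)=X(\check\tau^u(t;0))$. **Cascade observer.** With $\hat\nu=\frac{\lambda^u}{\lambda^u+\lambda^v}$ and $\hat\mu=\lambda^v\hat\nu$, the PDE part $\hat w=(\hat u,\hat v)$ solves, in the broad sense, $$\hat u_x=\frac{f^u(x,\hat w)}{\lambda^u(x)},\quad \hat v_t=\hat\mu(x)\hat v_x+\hat\nu(x)f^v(x,\hat w),\quad \hat u(1,t)=Y(t),\quad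 \hat v(1,t)=U(t),\quad \hat w(\cdot,0)=\hat w_0,$$ and the ODE part solves $$\dot{\hat X}(t)=h(\hat X(t),\hat u(0,t),\hat v(0,t),\check\tau^u(t;0)),\ t\ge 0,\qquad \hat X(0)=\hat X_0.$$ **Theorem.** There exists $T>0$, depending only on the system data and $h$, such that for every initial guess $(\hat w_0,\hat X_0)\in L^\infty(0,1)^2\times\mathbb R^n$ and all $Y,U\in L^\infty(0,\infty)$ the following holds. 1. The PDE part of the observer has a solution $\hat w$ on $[0,1]\times[0,\infty)$. 2. For every broad solution $(u,v,X)$ of the system on $[0,\infty)$ (with any initial data) with input $U$ and boundary measurement $Y=u(1,\cdot)$, and every solution $\hat w$ of the PDE part of the observer, $\hat w(\cdot,t)=\check w(\cdot,t)$ for $t\ge T$ in the $L^\infty$ sense: for almost every $t\ge T$ the equality holds for almost every $x\in[0,1]$, and for each fixed $x\in[0,1]$ (in particular $x=0$) it holds for almost every $t\ge T$. Moreover, every solution $\hat X$ on $[0,\infty)$ of the ODE part satisfies $\hat X(t)=\check X(t)$ for all $t\ge T$. -/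

import Mathlib

open MeasureTheory Set

namespace SemilinearObserver

noncomputable section

/-- Data of the semilinear system
`u_t = -lamU(x) u_x + fU(x,u,v)`, `v_t = lamV(x) v_x + fV(x,u,v)` on `0 ≤ x ≤ 1`, coupled at `x = 0`
to the ODE `X' = f0(X, v(0,t), t)` through `u(0,t) = g0(X, v(0,t), t)`. -/
structure System (n : ℕ) where
  lamU : ℝ → ℝ
  lamV : ℝ → ℝ
  fU : ℝ → ℝ → ℝ → ℝ
  fV : ℝ → ℝ → ℝ → ℝ
  f0 : EuclideanSpace ℝ (Fin n) → ℝ → ℝ → EuclideanSpace ℝ (Fin n)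
  g0 : EuclideanSpace ℝ (Fin n) → ℝ → ℝ → ℝ

/-- Standing assumptions: positive speeds bounded away from zero; source terms and coupling
functions globally Lipschitz in the state, uniformly in `x` resp. `t`, vanishing at the origin, and
measurable in `x` resp. `t`. -/
structure System.Admissible {n : ℕ} (S : System n) : Prop where
  meas_lamU : Measurable S.lamU
  meas_lamV : Measurable S.lamV
  lamU_pos : ∀ x ∈ Icc (0 : ℝ) 1, 0 < S.lamU x
  lamV_pos : ∀ x ∈ Icc (0 : ℝ) 1, 0 < S.lamV x
  inv_speed_le : ∃ l : ℝ, ∀ x ∈ Icc (0 : ℝ) 1, max (S.lamU x)⁻¹ (S.lamV x)⁻¹ ≤ l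
  meas_fU : ∀ a b : ℝ, Measurable fun x => S.fU x a b
  meas_fV : ∀ a b : ℝ, Measurable fun x => S.fV x a b
  meas_f0 : ∀ (z : EuclideanSpace ℝ (Fin n)) (b : ℝ), Measurable fun t => S.f0 z b t
  meas_g0 : ∀ (z : EuclideanSpace ℝ (Fin n)) (b : ℝ), Measurable fun t => S.g0 z b t
  lip_F : ∃ L : ℝ, ∀ x ∈ Icc (0 : ℝ) 1, ∀ a b a' b' : ℝ,
    |S.fU x a b - S.fU x a' b'| ≤ L * max |a - a'| |b - b'| ∧
    |S.fV x a b - S.fV x a' b'| ≤ L * max |a - a'| |b - b'|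
  lip_f0 : ∃ L : ℝ, ∀ t : ℝ, 0 ≤ t → ∀ (z z' : EuclideanSpace ℝ (Fin n)) (b b' : ℝ),
    ‖S.f0 z b t - S.f0 z' b' t‖ ≤ L * (‖z - z'‖ + |b - b'|)
  lip_g0 : ∃ L : ℝ, ∀ t : ℝ, 0 ≤ t → ∀ (z z' : EuclideanSpace ℝ (Fin n)) (b b' : ℝ),
    |S.g0 z b t - S.g0 z' b' t| ≤ L * (‖z - z'‖ + |b - b'|)
  F_zero : ∀ x ∈ Icc (0 : ℝ) 1, S.fU x 0 0 = 0 ∧ S.fV x 0 0 = 0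
  f0_zero : ∀ t : ℝ, 0 ≤ t → S.f0 0 0 t = 0
  g0_zero : ∀ t : ℝ, 0 ≤ t → S.g0 0 0 t = 0

/-- Time at which the rightgoing characteristic through `(y, t)` reaches `x`. -/
def System.charU {n : ℕ} (S : System n) (y t x : ℝ) : ℝ := t + ∫ ξ in y..x, 1 / S.lamU ξ

/-- Time at which the leftgoing characteristic through `(y, t)` reaches `x`. -/
def System.charV {n : ℕ} (S : System n) (y t x : ℝ) : ℝ := t + ∫ ξ in x..y, 1 / S.lamV ξ

/-- The characteristic line of `u` that reaches `x = 1` at time `t`. -/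
def System.tauCheck {n : ℕ} (S : System n) (t x : ℝ) : ℝ := t - ∫ ξ in x..(1 : ℝ), 1 / S.lamU ξ

def System.nuHat {n : ℕ} (S : System n) (x : ℝ) : ℝ := S.lamU x / (S.lamU x + S.lamV x)

def System.muHat {n : ℕ} (S : System n) (x : ℝ) : ℝ := S.lamV x * S.nuHat x

/-- Time at which the characteristic of `∂ₜ - muHat ∂ₓ` through `(y, t)` reaches `x`. -/
def System.charHat {n : ℕ} (S : System n) (y t x : ℝ) : ℝ := t + ∫ ξ in x..y, 1 / S.muHat ξ

/-- `z` is a (Caratheodory) solution of `z'(t) = G(t, z(t))` on `[s, ∞)`. -/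
def IsODESolution {n : ℕ} (G : ℝ → EuclideanSpace ℝ (Fin n) → EuclideanSpace ℝ (Fin n)) (s : ℝ)
    (z : ℝ → EuclideanSpace ℝ (Fin n)) : Prop :=
  ∀ t : ℝ, s ≤ t → IntervalIntegrable (fun r => G r (z r)) volume s t ∧
    z t = z s + ∫ r in s..t, G r (z r)

/-- `a` is essentially bounded on `[0,1] × [0,τ]` for every `τ`. -/
def LocallyEssBounded (a : ℝ → ℝ → ℝ) : Prop :=
  ∀ τ : ℝ, MemLp (fun p : ℝ × ℝ => a p.1 p.2) ⊤
    (volume.restrict (Icc (0 : ℝ) 1 ×ˢ Icc (0 : ℝ) τ))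

/-- Broad solution `(u, v, X)` of the semilinear system on `[0,1] × [0,∞)` with input `U` and initial
condition `(u0, v0, X0)`: the integral equations along almost every characteristic line (those
that start at the inflow boundary and those that start at `t = 0`), together with the ODE. -/
structure System.IsBroadSolution {n : ℕ} (S : System n) (U u0 v0 : ℝ → ℝ)
    (X0 : EuclideanSpace ℝ (Fin n)) (u v : ℝ → ℝ → ℝ) (X : ℝ → EuclideanSpace ℝ (Fin n)) :
    Prop where
  bdd_u : LocallyEssBounded u
  bdd_v : LocallyEssBounded v
  bc_u : ∀ᵐ t : ℝ, 0 ≤ t → u 0 t = S.g0 (X t) (v 0 t) t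
  bc_v : ∀ᵐ t : ℝ, 0 ≤ t → v 1 t = U t
  ic_u : ∀ᵐ x : ℝ, x ∈ Icc (0 : ℝ) 1 → u x 0 = u0 x
  ic_v : ∀ᵐ x : ℝ, x ∈ Icc (0 : ℝ) 1 → v x 0 = v0 x
  char_u_bdry : ∀ᵐ t : ℝ, 0 ≤ t → ∀ x ∈ Icc (0 : ℝ) 1,
    u x (S.charU 0 t x) = u 0 t + ∫ ξ in (0 : ℝ)..x,
      S.fU ξ (u ξ (S.charU 0 t ξ)) (v ξ (S.charU 0 t ξ)) / S.lamU ξ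
  char_u_init : ∀ᵐ y : ℝ, y ∈ Icc (0 : ℝ) 1 → ∀ x ∈ Icc y 1,
    u x (S.charU y 0 x) = u y 0 + ∫ ξ in y..x,
      S.fU ξ (u ξ (S.charU y 0 ξ)) (v ξ (S.charU y 0 ξ)) / S.lamU ξ
  char_v_bdry : ∀ᵐ t : ℝ, 0 ≤ t → ∀ x ∈ Icc (0 : ℝ) 1,
    v x (S.charV 1 t x) = v 1 t + ∫ ξ in x..(1 : ℝ),
      S.fV ξ (u ξ (S.charV 1 t ξ)) (v ξ (S.charV 1 t ξ)) / S.lamV ξ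
  char_v_init : ∀ᵐ y : ℝ, y ∈ Icc (0 : ℝ) 1 → ∀ x ∈ Icc (0 : ℝ) y,
    v x (S.charV y 0 x) = v y 0 + ∫ ξ in x..y,
      S.fV ξ (u ξ (S.charV y 0 ξ)) (v ξ (S.charV y 0 ξ)) / S.lamV ξ
  ode : IsODESolution (fun t z => S.f0 z (v 0 t) t) 0 X
  ic_X : X 0 = X0

/-- Broad solution `(uh, vh)` of the PDE part of the observer:
`∂ₓ uh = fU(x,uh,vh) / lamU`, `∂ₜ vh = muHat ∂ₓ vh + nuHat fV(x,uh,vh)`, `uh(1,t) = Y(t)`,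
`vh(1,t) = U(t)`, `(uh,vh)(·,0) = (uh0,vh0)`. The first equation is an ODE in `x` for almost every
`t`, so the value of `uh` at the single time `t = 0` does not influence the solution. -/
structure System.IsPDEObserver {n : ℕ} (S : System n) (Y U uh0 vh0 : ℝ → ℝ)
    (uh vh : ℝ → ℝ → ℝ) : Prop where
  bdd_u : LocallyEssBounded uh
  bdd_v : LocallyEssBounded vh
  bc_u : ∀ᵐ t : ℝ, 0 ≤ t → uh 1 t = Y t
  bc_v : ∀ᵐ t : ℝ, 0 ≤ t → vh 1 t = U t
  ic_u : ∀ᵐ x : ℝ, x ∈ Icc (0 : ℝ) 1 → uh x 0 = uh0 x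
  ic_v : ∀ᵐ x : ℝ, x ∈ Icc (0 : ℝ) 1 → vh x 0 = vh0 x
  eq_u : ∀ᵐ t : ℝ, 0 ≤ t → ∀ x ∈ Icc (0 : ℝ) 1,
    uh x t = uh 1 t - ∫ ξ in x..(1 : ℝ), S.fU ξ (uh ξ t) (vh ξ t) / S.lamU ξ
  char_v_bdry : ∀ᵐ t : ℝ, 0 ≤ t → ∀ x ∈ Icc (0 : ℝ) 1,
    vh x (S.charHat 1 t x) = vh 1 t + ∫ ξ in x..(1 : ℝ),
      S.nuHat ξ * S.fV ξ (uh ξ (S.charHat 1 t ξ)) (vh ξ (S.charHat 1 t ξ)) / S.muHat ξ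
  char_v_init : ∀ᵐ y : ℝ, y ∈ Icc (0 : ℝ) 1 → ∀ x ∈ Icc (0 : ℝ) y,
    vh x (S.charHat y 0 x) = vh y 0 + ∫ ξ in x..y,
      S.nuHat ξ * S.fV ξ (uh ξ (S.charHat y 0 ξ)) (vh ξ (S.charHat y 0 ξ)) / S.muHat ξ

/-- `h` is a finite-time observer for the ODE part `X' = f0(X, v, t)` with input `v` and output
`g0(X, v, t)`: started at any time `s ≥ 0` with any guess, for any input signal in `L^∞` and any
trajectory of the ODE, the estimate equals the state after a time `Th` that depends on none of
these. -/
def System.IsFiniteTimeObserver {n : ℕ} (S : System n)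
    (h : EuclideanSpace ℝ (Fin n) → ℝ → ℝ → ℝ → EuclideanSpace ℝ (Fin n)) : Prop :=
  ∃ Th : ℝ, 0 < Th ∧ ∀ s : ℝ, 0 ≤ s → ∀ v : ℝ → ℝ, MemLp v ⊤ (volume.restrict (Ici s)) →
    ∀ X Xh : ℝ → EuclideanSpace ℝ (Fin n),
      IsODESolution (fun t z => S.f0 z (v t) t) s X →
      IsODESolution (fun t z => h z (S.g0 (X t) (v t) t) (v t) t) s Xh →
      ∀ t : ℝ, s + Th ≤ t → Xh t = X t

/-- ODE part of the observer: `Xh' = h(Xh, uh(0,t), vh(0,t), tauCheck(t;0))`, `Xh(0) = Xh0`. -/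
def System.IsODEObserver {n : ℕ} (S : System n)
    (h : EuclideanSpace ℝ (Fin n) → ℝ → ℝ → ℝ → EuclideanSpace ℝ (Fin n))
    (Xh0 : EuclideanSpace ℝ (Fin n)) (uh vh : ℝ → ℝ → ℝ) (Xh : ℝ → EuclideanSpace ℝ (Fin n)) :
    Prop :=
  IsODESolution (fun t z => h z (uh 0 t) (vh 0 t) (S.tauCheck t 0)) 0 Xh ∧ Xh 0 = Xh0

end

end SemilinearObserver

namespace SemilinearObserver

open scoped ENNReal NNReal

/-! Exchange the roles of `x` and `t`. Sampled along the `u`-characteristic that reaches `x = 1` at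
time `t`, the plant state satisfies an ODE in `x` for its `u`-part. Its `v`-part is transported
along lines whose slowness is the sum `1/lamU + 1/lamV = 1/muHat`. Hence for `t ≥ timeU 0`, where
all sampled times are nonnegative, the past state solves the observer equations, with the data `Y`,
`U` at `x = 1`. Both objects are instances of `IsMarching`, a system evolving from `x = 1` down to
`x = 0`.

For two solutions with equal data, the distance at `(x, t)` is bounded by integrals of the distance
over `(x, 1]` along the two families of lines. Integrate in `t` over the domain of determinacy `t ≥
t0 + timeHat x`, truncated at a finite time: translations drop out, and a Gronwall inequality in `x`
alone remains. This gives `IsMarching.unique`, hence exact agreement from `timeU 0 + timeHat 0` on.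

Existence is Picard iteration in the norm weighted by `exp (k (1 - x))`
(`exists_marchOp_fixedPoint`), after the initial value of `vh` is turned into a datum at `x = 1` for
negative times.

After agreement, the ODE estimate, shifted by `timeU 0`, is an observer trajectory driven by the
true signals, so it converges within a further `Th`. -/

/-! ### Backward Gronwall inequality with an exponential weight. -/

theorem integral_exp_weight_le {k : ℝ} (hk : 0 < k) {x : ℝ} (hx : x ≤ 1) :
    ∫ ξ in Ioc x 1, Real.exp (k * (1 - ξ)) ≤ Real.exp (k * (1 - x)) / k := by
  have hd : ∀ ξ ∈ uIcc x 1, HasDerivAt (fun y => -(Real.exp (k * (1 - y)) / k))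
      (Real.exp (k * (1 - ξ))) ξ := by
    intro ξ _
    have h1 : HasDerivAt (fun y : ℝ => k * (1 - y)) (k * (-1)) ξ :=
      ((hasDerivAt_id ξ).const_sub 1).const_mul k
    refine (h1.exp.div_const k).neg.congr_deriv ?_
    field_simp
  rw [← intervalIntegral.integral_of_le hx, intervalIntegral.integral_eq_sub_of_hasDerivAt hd
    (Continuous.intervalIntegrable (by fun_prop) _ _)]
  have : 0 < 1 / k := by positivity
  simp
  positivity

theorem lintegral_exp_weight_le {k : ℝ} (hk : 0 < k) {x : ℝ} (hx : x ≤ 1) :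
    ∫⁻ ξ in Ioc x 1, ENNReal.ofReal (Real.exp (k * (1 - ξ)))
      ≤ ENNReal.ofReal (Real.exp (k * (1 - x)) / k) := by
  rw [← ofReal_integral_eq_lintegral_ofReal]
  · exact ENNReal.ofReal_le_ofReal (integral_exp_weight_le hk hx)
  · exact ((by fun_prop : Continuous fun ξ : ℝ => Real.exp (k * (1 - ξ))).integrableOn_Icc).mono_set
      Ioc_subset_Icc_self
  · exact Filter.Eventually.of_forall fun _ => (Real.exp_pos _).le

/-- Backward Gronwall lemma for extended nonnegative functions. -/
theorem lintegral_eq_zero_of_le_tail {w : ℝ → ℝ≥0∞} {K : ℝ} (hK : 0 ≤ K)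
    (hfin : ∫⁻ x in Ioc (0 : ℝ) 1, w x ≠ ⊤)
    (h : ∀ x ∈ Icc (0 : ℝ) 1, w x ≤ ENNReal.ofReal K * ∫⁻ ξ in Ioc x 1, w ξ) :
    ∫⁻ x in Ioc (0 : ℝ) 1, w x = 0 := by
  -- Inserting a bound `c * exp (k (1 - x))` into `h` and integrating multiplies it by `K / k ≤
  -- 1/2`; the `+ 1` keeps `k` positive when `K = 0`. Iteration from the finite total mass forces
  -- zero.
  set k : ℝ := 2 * K + 1 with hk
  have hk0 : 0 < k := by positivity
  set M := (∫⁻ x in Ioc (0 : ℝ) 1, w x).toReal with hM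
  have hM0 : 0 ≤ M := ENNReal.toReal_nonneg
  have key : ∀ m : ℕ, ∀ x ∈ Icc (0 : ℝ) 1, ∫⁻ ξ in Ioc x 1, w ξ ≤
      ENNReal.ofReal (M * (1 / 2) ^ m) * ENNReal.ofReal (Real.exp (k * (1 - x))) := by
    intro m
    induction m with
    | zero =>
      intro x hx
      calc ∫⁻ ξ in Ioc x 1, w ξ ≤ ∫⁻ ξ in Ioc 0 1, w ξ :=
            lintegral_mono_set (Ioc_subset_Ioc_left hx.1)
        _ = ENNReal.ofReal M := (ENNReal.ofReal_toReal hfin).symm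
        _ ≤ _ := by
          rw [← ENNReal.ofReal_mul (by positivity)]
          apply ENNReal.ofReal_le_ofReal
          have : 1 ≤ Real.exp (k * (1 - x)) :=
            Real.one_le_exp (mul_nonneg hk0.le (by linarith [hx.2]))
          nlinarith
    | succ m ih =>
      intro x hx
      calc ∫⁻ ξ in Ioc x 1, w ξ
          ≤ ∫⁻ ξ in Ioc x 1, ENNReal.ofReal (K * (M * (1 / 2) ^ m)) *
              ENNReal.ofReal (Real.exp (k * (1 - ξ))) := by
            refine setLIntegral_mono' measurableSet_Ioc fun ξ hξ => ?_
            have hξ' : ξ ∈ Icc (0 : ℝ) 1 := ⟨hx.1.trans hξ.1.le, hξ.2⟩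
            refine (h ξ hξ').trans ?_
            rw [ENNReal.ofReal_mul hK, mul_assoc]
            gcongr
            exact ih ξ hξ'
        _ = ENNReal.ofReal (K * (M * (1 / 2) ^ m)) *
              ∫⁻ ξ in Ioc x 1, ENNReal.ofReal (Real.exp (k * (1 - ξ))) :=
            lintegral_const_mul _ (by fun_prop)
        _ ≤ ENNReal.ofReal (K * (M * (1 / 2) ^ m)) *
              ENNReal.ofReal (Real.exp (k * (1 - x)) / k) := by
            gcongr
            exact lintegral_exp_weight_le hk0 hx.2
        _ ≤ _ := by
            rw [← ENNReal.ofReal_mul (by positivity), ← ENNReal.ofReal_mul (by positivity)]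
            apply ENNReal.ofReal_le_ofReal
            have hKk : K / k ≤ 1 / 2 := by
              rw [div_le_iff₀ hk0, hk]; linarith
            have h0 : 0 ≤ M * (1 / 2) ^ m * Real.exp (k * (1 - x)) := by positivity
            calc K * (M * (1 / 2) ^ m) * (Real.exp (k * (1 - x)) / k)
                = (K / k) * (M * (1 / 2) ^ m * Real.exp (k * (1 - x))) := by ring
              _ ≤ (1 / 2) * (M * (1 / 2) ^ m * Real.exp (k * (1 - x))) := by gcongr
              _ = _ := by ring
  have hlim : Filter.Tendsto (fun m : ℕ => ENNReal.ofReal (M * (1 / 2) ^ m) *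
      ENNReal.ofReal (Real.exp (k * (1 - 0)))) Filter.atTop (nhds 0) := by
    have h1 : Filter.Tendsto (fun m : ℕ => M * (1 / 2 : ℝ) ^ m * Real.exp (k * (1 - 0)))
        Filter.atTop (nhds 0) := by
      simpa using ((tendsto_pow_atTop_nhds_zero_of_lt_one (by norm_num)
        (by norm_num : (1 / 2 : ℝ) < 1)).const_mul M).mul_const (Real.exp (k * (1 - 0)))
    have h2 := ENNReal.tendsto_ofReal h1
    rw [ENNReal.ofReal_zero] at h2
    refine h2.congr fun m => ?_
    rw [ENNReal.ofReal_mul (by positivity)]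
  exact le_antisymm (ge_of_tendsto' hlim fun m => key m 0 (by simp)) bot_le

/-! ### Lipschitz sources and integrability along sheared curves. -/

/-- Source terms that vanish at the origin and are Lipschitz in the state. -/
structure IsLipSource (K : ℝ) (F : ℝ → ℝ → ℝ → ℝ) : Prop where
  nonneg : 0 ≤ K
  meas : ∀ a b, Measurable fun x => F x a b
  lip : ∀ x a b a' b', |F x a b - F x a' b'| ≤ K * max |a - a'| |b - b'|
  zero : ∀ x, F x 0 0 = 0

/-- Carathéodory argument: measurable in `x` and continuous in the state implies jointly measurable.
-/
theorem IsLipSource.measurable {K : ℝ} {F : ℝ → ℝ → ℝ → ℝ} (hF : IsLipSource K F) :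
    Measurable fun q : ℝ × ℝ × ℝ => F q.1 q.2.1 q.2.2 := by
  have h : Measurable (Function.uncurry fun (q : ℝ × ℝ) (x : ℝ) => F x q.1 q.2) := by
    refine measurable_uncurry_of_continuous_of_measurable (fun x => ?_) (fun q => hF.meas q.1 q.2)
    refine (LipschitzWith.of_dist_le_mul (K := K.toNNReal) fun p q => ?_).continuous
    rw [Real.coe_toNNReal _ hF.nonneg, Real.dist_eq, Prod.dist_eq, Real.dist_eq, Real.dist_eq]
    exact hF.lip x _ _ _ _
  exact h.comp (measurable_snd.prodMk measurable_fst)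

theorem IsLipSource.abs_le {K : ℝ} {F : ℝ → ℝ → ℝ → ℝ} (hF : IsLipSource K F) (x a b : ℝ) :
    |F x a b| ≤ K * max |a| |b| := by
  simpa [hF.zero] using hF.lip x a b 0 0

theorem IsLipSource.integrable_comp {K : ℝ} {F : ℝ → ℝ → ℝ → ℝ} (hF : IsLipSource K F)
    {μ : Measure ℝ} {p q : ℝ → ℝ} (hp : Integrable p μ) (hq : Integrable q μ) :
    Integrable (fun ξ => F ξ (p ξ) (q ξ)) μ := by
  refine Integrable.mono' ((hp.abs.add hq.abs).const_mul K) ?_ ?_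
  · exact (hF.measurable.comp_aemeasurable
      (aemeasurable_id.prodMk (hp.aemeasurable.prodMk hq.aemeasurable))).aestronglyMeasurable
  · refine Filter.Eventually.of_forall fun ξ => (hF.abs_le ξ _ _).trans ?_
    refine mul_le_mul_of_nonneg_left ?_ hF.nonneg
    exact max_le (le_add_of_nonneg_right (abs_nonneg _)) (le_add_of_nonneg_left (abs_nonneg _))

/-- On each line `x = const` the map is a translation. It carries Fubini arguments from horizontal
lines to translates of a curve. -/
theorem measurePreserving_shear {s : ℝ → ℝ} (hs : Measurable s) :
    MeasurePreserving (fun p : ℝ × ℝ => (p.1, p.2 + s p.1)) volume volume := by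
  have := (MeasurePreserving.id (volume : Measure ℝ)).skew_product
    (g := fun x t : ℝ => t + s x) (μc := (volume : Measure ℝ)) (μd := volume)
    (by simp only [Function.uncurry_def]; fun_prop)
    (Filter.Eventually.of_forall fun x => (measurePreserving_add_right volume (s x)).map_eq)
  exact this

/-- Restriction of a locally integrable function to almost every translate of a curve. -/
theorem ae_integrableOn_curve {a : ℝ → ℝ → ℝ} {t0 : ℝ}
    (ha : ∀ τ, IntegrableOn (fun p : ℝ × ℝ => a p.1 p.2) (Icc 0 1 ×ˢ Icc t0 τ))
    {s : ℝ → ℝ} (hs : Measurable s) {c : ℝ} (hc : ∀ ξ ∈ Icc (0 : ℝ) 1, s ξ ≤ c) :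
    ∀ᵐ t : ℝ, (∀ ξ ∈ Icc (0 : ℝ) 1, t0 ≤ t + s ξ) →
      IntegrableOn (fun ξ => a ξ (t + s ξ)) (Icc 0 1) := by
  have key : ∀ m : ℕ, ∀ᵐ t : ℝ, Integrable (fun ξ =>
      (Icc (0 : ℝ) 1 ×ˢ Icc t0 (m : ℝ)).indicator (fun p : ℝ × ℝ => a p.1 p.2) (ξ, t + s ξ)) := by
    intro m
    have h1 := (ha m).integrable_indicator (measurableSet_Icc.prod measurableSet_Icc)
    have h2 := (measurePreserving_shear hs).integrable_comp_of_integrable h1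
    exact h2.prod_left_ae
  filter_upwards [ae_all_iff.2 key] with t ht h0
  obtain ⟨m, hm⟩ := exists_nat_ge (t + c)
  have h := (ht m).integrableOn (s := Icc 0 1)
  refine h.congr_fun (fun ξ hξ => ?_) measurableSet_Icc
  have : (ξ, t + s ξ) ∈ Icc (0 : ℝ) 1 ×ˢ Icc t0 (m : ℝ) :=
    ⟨hξ, h0 ξ hξ, by simp only; linarith [hc ξ hξ]⟩
  simp only [indicator_of_mem this]

/-! ### Marching systems: uniqueness in the domain of determinacy. -/

/-- Solutions of the system in which `x` plays the role of time and runs from `1` to `0`: `a` is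
transported along `t = const`, `b` along `t = θ + ψ x`, and the data at `x = 1` are `Y` and `U`. -/
structure IsMarching (F G : ℝ → ℝ → ℝ → ℝ) (ψ : ℝ → ℝ) (t0 : ℝ) (Y U : ℝ → ℝ)
    (a b : ℝ → ℝ → ℝ) : Prop where
  int_a : ∀ τ, IntegrableOn (fun p : ℝ × ℝ => a p.1 p.2) (Icc 0 1 ×ˢ Icc t0 τ)
  int_b : ∀ τ, IntegrableOn (fun p : ℝ × ℝ => b p.1 p.2) (Icc 0 1 ×ˢ Icc t0 τ)
  eq_a : ∀ᵐ t : ℝ, t0 ≤ t → ∀ x ∈ Icc (0 : ℝ) 1,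
    a x t = Y t - ∫ ξ in Ioc x 1, F ξ (a ξ t) (b ξ t)
  eq_b : ∀ᵐ θ : ℝ, t0 ≤ θ → ∀ x ∈ Icc (0 : ℝ) 1,
    b x (θ + ψ x) = U θ + ∫ ξ in Ioc x 1, G ξ (a ξ (θ + ψ ξ)) (b ξ (θ + ψ ξ))

theorem IsLipSource.enorm_integral_sub_le {K : ℝ} {F : ℝ → ℝ → ℝ → ℝ} (hF : IsLipSource K F)
    {p q p' q' : ℝ → ℝ} (hp : IntegrableOn p (Icc 0 1)) (hq : IntegrableOn q (Icc 0 1))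
    (hp' : IntegrableOn p' (Icc 0 1)) (hq' : IntegrableOn q' (Icc 0 1)) {x : ℝ} (hx : 0 ≤ x) :
    ‖(∫ ξ in Ioc x 1, F ξ (p ξ) (q ξ)) - ∫ ξ in Ioc x 1, F ξ (p' ξ) (q' ξ)‖ₑ ≤
      ENNReal.ofReal K * ∫⁻ ξ in Ioc x 1, (‖p ξ - p' ξ‖ₑ + ‖q ξ - q' ξ‖ₑ) := by
  have hsub : Ioc x 1 ⊆ Icc 0 1 := fun ξ hξ => ⟨hx.trans hξ.1.le, hξ.2⟩
  rw [← integral_sub (hF.integrable_comp (hp.mono_set hsub) (hq.mono_set hsub))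
    (hF.integrable_comp (hp'.mono_set hsub) (hq'.mono_set hsub))]
  refine (enorm_integral_le_lintegral_enorm _).trans ?_
  rw [← lintegral_const_mul' _ _ ENNReal.ofReal_ne_top]
  refine lintegral_mono fun ξ => ?_
  simp only [Real.enorm_eq_ofReal_abs]
  rw [← ENNReal.ofReal_add (abs_nonneg _) (abs_nonneg _), ← ENNReal.ofReal_mul hF.nonneg]
  refine ENNReal.ofReal_le_ofReal ((hF.lip ξ _ _ _ _).trans ?_)
  refine mul_le_mul_of_nonneg_left ?_ hF.nonneg
  exact max_le (le_add_of_nonneg_right (abs_nonneg _)) (le_add_of_nonneg_left (abs_nonneg _))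

/-- Distance of two pairs of functions. -/
noncomputable def pairDist (a b a' b' : ℝ → ℝ → ℝ) (x t : ℝ) : ℝ≥0∞ :=
  ‖a x t - a' x t‖ₑ + ‖b x t - b' x t‖ₑ

section Uniqueness

variable {K : ℝ} {F G : ℝ → ℝ → ℝ → ℝ} {ψ : ℝ → ℝ} {t0 : ℝ} {Y U : ℝ → ℝ}
  {a b a' b' : ℝ → ℝ → ℝ}

theorem IsMarching.enorm_sub_le_left (hF : IsLipSource K F)
    (h : IsMarching F G ψ t0 Y U a b) (h' : IsMarching F G ψ t0 Y U a' b') :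
    ∀ᵐ t : ℝ, t0 ≤ t → ∀ x ∈ Icc (0 : ℝ) 1, ‖a x t - a' x t‖ₑ ≤
      ENNReal.ofReal K * ∫⁻ ξ in Ioc x 1, pairDist a b a' b' ξ t := by
  have hline : ∀ {f : ℝ → ℝ → ℝ},
      (∀ τ, IntegrableOn (fun p : ℝ × ℝ => f p.1 p.2) (Icc 0 1 ×ˢ Icc t0 τ)) →
      ∀ᵐ t : ℝ, t0 ≤ t → IntegrableOn (fun ξ => f ξ t) (Icc 0 1) := by
    intro f hf
    filter_upwards [ae_integrableOn_curve hf (s := fun _ => 0) measurable_const (c := 0)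
      (fun _ _ => le_rfl)] with t ht h0
    simpa using ht fun ξ _ => by simpa using h0
  filter_upwards [h.eq_a, h'.eq_a, hline h.int_a, hline h.int_b, hline h'.int_a, hline h'.int_b]
    with t e e' i1 i2 i3 i4 ht x hx
  rw [e ht x hx, e' ht x hx, sub_sub_sub_cancel_left, ← enorm_neg, neg_sub]
  exact hF.enorm_integral_sub_le (i1 ht) (i2 ht) (i3 ht) (i4 ht) hx.1

theorem IsMarching.enorm_sub_le_right (hG : IsLipSource K G) (hψ : Measurable ψ)
    (hψ0 : ∀ x ∈ Icc (0 : ℝ) 1, 0 ≤ ψ x) {c : ℝ} (hc : ∀ x ∈ Icc (0 : ℝ) 1, ψ x ≤ c)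
    (h : IsMarching F G ψ t0 Y U a b) (h' : IsMarching F G ψ t0 Y U a' b') :
    ∀ᵐ θ : ℝ, t0 ≤ θ → ∀ x ∈ Icc (0 : ℝ) 1, ‖b x (θ + ψ x) - b' x (θ + ψ x)‖ₑ ≤
      ENNReal.ofReal K * ∫⁻ ξ in Ioc x 1, pairDist a b a' b' ξ (θ + ψ ξ) := by
  have hline : ∀ {f : ℝ → ℝ → ℝ},
      (∀ τ, IntegrableOn (fun p : ℝ × ℝ => f p.1 p.2) (Icc 0 1 ×ˢ Icc t0 τ)) →
      ∀ᵐ θ : ℝ, t0 ≤ θ → IntegrableOn (fun ξ => f ξ (θ + ψ ξ)) (Icc 0 1) := by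
    intro f hf
    filter_upwards [ae_integrableOn_curve hf hψ hc] with t ht h0
    exact ht fun ξ hξ => by linarith [hψ0 ξ hξ]
  filter_upwards [h.eq_b, h'.eq_b, hline h.int_a, hline h.int_b, hline h'.int_a, hline h'.int_b]
    with t e e' i1 i2 i3 i4 ht x hx
  rw [e ht x hx, e' ht x hx, add_sub_add_left_eq_sub]
  exact hG.enorm_integral_sub_le (i1 ht) (i2 ht) (i3 ht) (i4 ht) hx.1

/-- Domain in which the solution is determined by the data at `x = 1` on `[t0, τ]`. -/
def determinacySet (ψ : ℝ → ℝ) (t0 τ : ℝ) : Set (ℝ × ℝ) :=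
  {p | p.1 ∈ Icc (0 : ℝ) 1 ∧ t0 + ψ p.1 ≤ p.2 ∧ p.2 ≤ τ}

theorem measurableSet_determinacySet (hψ : Measurable ψ) (τ : ℝ) :
    MeasurableSet (determinacySet ψ t0 τ) :=
  (measurable_fst measurableSet_Icc).inter
    ((measurableSet_le (by fun_prop) measurable_snd).inter
      (measurableSet_le measurable_snd measurable_const))

/-- Distance of two solutions, cut off outside the domain of determinacy. -/
noncomputable def cutDist (ψ : ℝ → ℝ) (t0 τ : ℝ) (a b a' b' : ℝ → ℝ → ℝ) (x t : ℝ) : ℝ≥0∞ :=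
  (determinacySet ψ t0 τ).indicator (fun p => pairDist a b a' b' p.1 p.2) (x, t)

theorem IsMarching.cutDist_aemeasurable_and_finite (hψ : Measurable ψ)
    (hψ0 : ∀ x ∈ Icc (0 : ℝ) 1, 0 ≤ ψ x) (h : IsMarching F G ψ t0 Y U a b)
    (h' : IsMarching F G ψ t0 Y U a' b') (τ : ℝ) :
    AEMeasurable (fun p : ℝ × ℝ => cutDist ψ t0 τ a b a' b' p.1 p.2) ∧
      ∫⁻ p : ℝ × ℝ, cutDist ψ t0 τ a b a' b' p.1 p.2 ≠ ⊤ := by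
  have hD := measurableSet_determinacySet (t0 := t0) hψ τ
  have hsub : determinacySet ψ t0 τ ⊆ Icc 0 1 ×ˢ Icc t0 τ := by
    rintro ⟨x, t⟩ ⟨h1, h2, h3⟩
    exact ⟨h1, by have := hψ0 x h1; simp only at h2 ⊢; linarith, h3⟩
  have i1 := ((h.int_a τ).sub (h'.int_a τ)).mono_set hsub
  have i2 := ((h.int_b τ).sub (h'.int_b τ)).mono_set hsub
  have hm : AEMeasurable (fun p : ℝ × ℝ => pairDist a b a' b' p.1 p.2)
      (volume.restrict (determinacySet ψ t0 τ)) := i1.1.enorm.add i2.1.enorm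
  refine ⟨(aemeasurable_indicator_iff hD).2 hm, ?_⟩
  have : ∫⁻ p : ℝ × ℝ, cutDist ψ t0 τ a b a' b' p.1 p.2 =
      ∫⁻ p in determinacySet ψ t0 τ, pairDist a b a' b' p.1 p.2 := lintegral_indicator hD _
  rw [this]
  have h2 : ∫⁻ p in determinacySet ψ t0 τ, pairDist a b a' b' p.1 p.2 = _ :=
    lintegral_add_left' i1.1.enorm _
  rw [h2]
  exact ENNReal.add_ne_top.2 ⟨i1.2.ne, i2.2.ne⟩

/-- Right-hand side of the integral inequality for the distance of two solutions. -/
noncomputable def tailDist (K : ℝ) (ψ : ℝ → ℝ) (W : ℝ → ℝ → ℝ≥0∞) (x t : ℝ) : ℝ≥0∞ :=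
  ENNReal.ofReal K *
    ((∫⁻ ξ in Ioc x 1, W ξ t) + ∫⁻ ξ in Ioc x 1, W ξ (t - ψ x + ψ ξ))

/-- The cut-off is harmless because the domain of determinacy is stable under following either line
from `(x, t)` towards `x = 1`: since `ψ` decreases, `(ξ, t)` and `(ξ, t - ψ x + ψ ξ)` stay inside
for `ξ > x`. -/
theorem IsMarching.cutDist_le_tailDist (hF : IsLipSource K F) (hG : IsLipSource K G)
    (hψ : Measurable ψ) (hψa : AntitoneOn ψ (Icc 0 1)) (hψ1 : ψ 1 = 0)
    (h : IsMarching F G ψ t0 Y U a b) (h' : IsMarching F G ψ t0 Y U a' b') (τ : ℝ)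
    {x : ℝ} (hx : x ∈ Icc (0 : ℝ) 1) :
    ∀ᵐ t : ℝ, cutDist ψ t0 τ a b a' b' x t ≤
      tailDist K ψ (cutDist ψ t0 τ a b a' b') x t := by
  have hψ0 : ∀ x ∈ Icc (0 : ℝ) 1, 0 ≤ ψ x := fun x hx =>
    hψ1 ▸ hψa hx (right_mem_Icc.2 zero_le_one) hx.2
  have hψc : ∀ x ∈ Icc (0 : ℝ) 1, ψ x ≤ ψ 0 := fun x hx =>
    hψa (left_mem_Icc.2 zero_le_one) hx hx.1
  -- The second estimate holds for almost every label `θ`; with `x` fixed, translation by `ψ x`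
  -- makes it one for almost every `t`.
  filter_upwards [h.enorm_sub_le_left hF h', (measurePreserving_sub_right volume
    (ψ x)).quasiMeasurePreserving.ae (h.enorm_sub_le_right hG hψ hψ0 hψc h')] with t h1 h2
  by_cases hxt : (x, t) ∈ determinacySet ψ t0 τ
  · have hlo : t0 + ψ x ≤ t := hxt.2.1
    have hhi : t ≤ τ := hxt.2.2
    have hmem : ∀ ξ ∈ Ioc x 1, ξ ∈ Icc (0 : ℝ) 1 ∧ ψ ξ ≤ ψ x := fun ξ hξ =>
      have h0 : ξ ∈ Icc (0 : ℝ) 1 := ⟨hx.1.trans hξ.1.le, hξ.2⟩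
      ⟨h0, hψa hx h0 hξ.1.le⟩
    have e1 := h1 (by linarith [hψ0 x hx]) x hx
    have e2 := h2 (by linarith) x hx
    rw [sub_add_cancel] at e2
    rw [cutDist, indicator_of_mem hxt, tailDist, mul_add]
    refine add_le_add (e1.trans_eq ?_) (e2.trans_eq ?_)
    · congr 1
      refine setLIntegral_congr_fun measurableSet_Ioc fun ξ hξ => ?_
      have : (ξ, t) ∈ determinacySet ψ t0 τ :=
        ⟨(hmem ξ hξ).1, by simp only; linarith [(hmem ξ hξ).2], hhi⟩
      rw [cutDist, indicator_of_mem this]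
    · congr 1
      refine setLIntegral_congr_fun measurableSet_Ioc fun ξ hξ => ?_
      have : (ξ, t - ψ x + ψ ξ) ∈ determinacySet ψ t0 τ :=
        ⟨(hmem ξ hξ).1, by simp only; linarith, by simp only; linarith [(hmem ξ hξ).2]⟩
      rw [cutDist, indicator_of_mem this]
  · rw [cutDist, indicator_of_notMem hxt]
    exact bot_le

/-- By Tonelli the `t`-integral moves inside, where it does not see the translation by `-ψ x + ψ ξ`.
Both tails therefore contribute equally, whence the factor `2 * K`. -/
theorem tailDist_aemeasurable_and_lintegral (hψ : Measurable ψ) {W : ℝ → ℝ → ℝ≥0∞}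
    (hW : AEMeasurable (fun p : ℝ × ℝ => W p.1 p.2)) (hK : 0 ≤ K) (x : ℝ) :
    AEMeasurable (tailDist K ψ W x) ∧
      ∫⁻ t, tailDist K ψ W x t = ENNReal.ofReal (2 * K) * ∫⁻ ξ in Ioc x 1, ∫⁻ t, W ξ t := by
  have hac : (volume.restrict (Ioc x 1)).prod (volume : Measure ℝ) ≪ volume :=
    (Measure.AbsolutelyContinuous.prod Measure.absolutelyContinuous_restrict
      Measure.AbsolutelyContinuous.rfl)
  have m1 : AEMeasurable (fun p : ℝ × ℝ => W p.1 p.2)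
      ((volume.restrict (Ioc x 1)).prod (volume : Measure ℝ)) := hW.mono_ac hac
  have m2 : AEMeasurable (fun p : ℝ × ℝ => W p.1 (p.2 - ψ x + ψ p.1))
      ((volume.restrict (Ioc x 1)).prod (volume : Measure ℝ)) := by
    have h2 := hW.comp_quasiMeasurePreserving
      (measurePreserving_shear (s := fun ξ => -ψ x + ψ ξ) (by fun_prop)).quasiMeasurePreserving
    refine (h2.mono_ac hac).congr (Filter.Eventually.of_forall fun p => ?_)
    simp only [Function.comp_def]
    congr 1; ring
  have m1' : AEMeasurable fun t => ∫⁻ ξ in Ioc x 1, W ξ t := m1.lintegral_prod_left'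
  have m2' : AEMeasurable fun t => ∫⁻ ξ in Ioc x 1, W ξ (t - ψ x + ψ ξ) :=
    m2.lintegral_prod_left'
  refine ⟨(m1'.add m2').const_mul _, ?_⟩
  have s1 : ∫⁻ t, ∫⁻ ξ in Ioc x 1, W ξ t = ∫⁻ ξ in Ioc x 1, ∫⁻ t, W ξ t :=
    (lintegral_lintegral_swap m1).symm
  have s2 : ∫⁻ t, ∫⁻ ξ in Ioc x 1, W ξ (t - ψ x + ψ ξ) = ∫⁻ ξ in Ioc x 1, ∫⁻ t, W ξ t := by
    rw [← lintegral_lintegral_swap m2]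
    refine lintegral_congr fun ξ => ?_
    have := lintegral_add_right_eq_self (μ := (volume : Measure ℝ)) (fun t => W ξ t) (-ψ x + ψ ξ)
    rw [← this]
    refine lintegral_congr fun t => ?_
    congr 1; ring
  have s3 : ∫⁻ t, tailDist K ψ W x t = _ :=
    lintegral_const_mul' (ENNReal.ofReal K) _ ENNReal.ofReal_ne_top
  rw [s3, lintegral_add_left' m1', s1, s2, ← two_mul, ← mul_assoc, mul_comm 2 K,
    ENNReal.ofReal_mul hK, ENNReal.ofReal_ofNat]

/-- Gronwall applies to `x ↦ ∫⁻ t, W x t`, which is controlled by its own tail and has finite total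
mass thanks to the cut-off at `τ`. -/
theorem IsMarching.cutDist_eq_zero (hF : IsLipSource K F) (hG : IsLipSource K G)
    (hψ : Measurable ψ) (hψa : AntitoneOn ψ (Icc 0 1)) (hψ1 : ψ 1 = 0)
    (h : IsMarching F G ψ t0 Y U a b) (h' : IsMarching F G ψ t0 Y U a' b') (τ : ℝ) :
    (∀ᵐ t : ℝ, ∀ᵐ x : ℝ, x ∈ Icc (0 : ℝ) 1 → cutDist ψ t0 τ a b a' b' x t = 0) ∧
      ∀ x ∈ Icc (0 : ℝ) 1, ∀ᵐ t : ℝ, cutDist ψ t0 τ a b a' b' x t = 0 := by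
  have hψ0 : ∀ x ∈ Icc (0 : ℝ) 1, 0 ≤ ψ x := fun x hx =>
    hψ1 ▸ hψa hx (right_mem_Icc.2 zero_le_one) hx.2
  obtain ⟨hm, hfin⟩ := h.cutDist_aemeasurable_and_finite hψ hψ0 h' τ
  set W := cutDist ψ t0 τ a b a' b' with hW
  have hR := tailDist_aemeasurable_and_lintegral (K := K) hψ hm hF.nonneg
  have hle : ∀ x ∈ Icc (0 : ℝ) 1, ∀ᵐ t, W x t ≤ tailDist K ψ W x t := fun x hx =>
    h.cutDist_le_tailDist hF hG hψ hψa hψ1 h' τ hx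
  have htot : ∫⁻ x, ∫⁻ t, W x t = ∫⁻ p : ℝ × ℝ, W p.1 p.2 := (lintegral_prod _ hm).symm
  have hzero : ∫⁻ x in Ioc (0 : ℝ) 1, ∫⁻ t, W x t = 0 := by
    refine lintegral_eq_zero_of_le_tail (K := 2 * K) (by linarith [hF.nonneg]) ?_ fun x hx => ?_
    · exact ne_top_of_le_ne_top (htot ▸ hfin) (setLIntegral_le_lintegral _ _)
    · exact (lintegral_mono_ae (hle x hx)).trans_eq (hR x).2
  -- A vanishing integral over `x` only controls almost every `x`; using the integral inequality
  -- once more reaches every `x`, in particular the trace at `0`.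
  have hfix : ∀ x ∈ Icc (0 : ℝ) 1, ∀ᵐ t : ℝ, W x t = 0 := by
    intro x hx
    have h0 : ∫⁻ t, tailDist K ψ W x t = 0 := by
      rw [(hR x).2, le_antisymm ((lintegral_mono_set (Ioc_subset_Ioc_left hx.1)).trans_eq hzero)
        bot_le, mul_zero]
    filter_upwards [hle x hx, (lintegral_eq_zero_iff' (hR x).1).1 h0] with t h1 h2
    exact le_antisymm (h1.trans_eq h2) bot_le
  refine ⟨?_, hfix⟩
  have hW0 : ∫⁻ p : ℝ × ℝ, W p.1 p.2 = 0 := by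
    rw [← htot]
    refine (lintegral_congr fun x => ?_).trans lintegral_zero
    by_cases hx : x ∈ Icc (0 : ℝ) 1
    · exact (lintegral_congr_ae (hfix x hx)).trans lintegral_zero
    · refine (lintegral_congr fun t => ?_).trans lintegral_zero
      exact indicator_of_notMem (fun hp => hx hp.1) _
  have h2 := (lintegral_eq_zero_iff' hm).1 hW0
  have h3 : ∀ᵐ p : ℝ × ℝ, W p.2 p.1 = 0 :=
    (Measure.measurePreserving_swap (μ := (volume : Measure ℝ))
      (ν := (volume : Measure ℝ))).quasiMeasurePreserving.ae h2
  filter_upwards [Measure.ae_ae_of_ae_prod h3] with t ht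
  filter_upwards [ht] with x hx _ using hx

/-- Two marching solutions with the same data at `x = 1` agree once these data have determined
them. -/
theorem IsMarching.unique (hF : IsLipSource K F) (hG : IsLipSource K G)
    (hψ : Measurable ψ) (hψa : AntitoneOn ψ (Icc 0 1)) (hψ1 : ψ 1 = 0)
    (h : IsMarching F G ψ t0 Y U a b) (h' : IsMarching F G ψ t0 Y U a' b') :
    (∀ᵐ t : ℝ, t0 + ψ 0 ≤ t → ∀ᵐ x : ℝ, x ∈ Icc (0 : ℝ) 1 → a x t = a' x t ∧ b x t = b' x t) ∧
      ∀ x ∈ Icc (0 : ℝ) 1, ∀ᵐ t : ℝ, t0 + ψ 0 ≤ t → a x t = a' x t ∧ b x t = b' x t := by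
  have hz : ∀ {x t : ℝ}, x ∈ Icc (0 : ℝ) 1 → t0 + ψ 0 ≤ t →
      (∀ m : ℕ, cutDist ψ t0 m a b a' b' x t = 0) → a x t = a' x t ∧ b x t = b' x t := by
    intro x t hx ht h0
    obtain ⟨m, hm⟩ := exists_nat_ge t
    have hmem : (x, t) ∈ determinacySet ψ t0 m :=
      ⟨hx, by have := hψa (left_mem_Icc.2 zero_le_one) hx hx.1; simp only; linarith, hm⟩
    have h1 := h0 m
    rw [cutDist, indicator_of_mem hmem, pairDist, add_eq_zero, enorm_eq_zero, enorm_eq_zero,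
      sub_eq_zero, sub_eq_zero] at h1
    exact h1
  -- Integer horizons suffice and leave only countably many null sets.
  have key := fun m : ℕ => h.cutDist_eq_zero hF hG hψ hψa hψ1 h' m
  refine ⟨?_, fun x hx => ?_⟩
  · filter_upwards [ae_all_iff.2 fun m => (key m).1] with t ht ht0
    filter_upwards [ae_all_iff.2 ht] with x hx hx1
    exact hz hx1 ht0 fun m => hx m hx1
  · filter_upwards [ae_all_iff.2 fun m => (key m).2 x hx] with t ht ht0
    exact hz hx ht0 ht

end Uniqueness

/-! ### Picard iteration in a weighted sup norm. -/

/-- Integrands of the integral operators solved by Picard iteration. -/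
structure IsMarchKernel (K : ℝ) (H : ℝ → ℝ → ℝ → ℝ → ℝ) : Prop where
  nonneg : 0 ≤ K
  meas : Measurable fun q : ℝ × ℝ × ℝ × ℝ => H q.1 q.2.1 q.2.2.1 q.2.2.2
  lip : ∀ x s a b a' b', |H x s a b - H x s a' b'| ≤ K * max |a - a'| |b - b'|
  zero : ∀ x s, H x s 0 0 = 0

/-- Jointly measurable functions with an exponential bound. -/
structure IsMarchFn (k : ℝ) (a : ℝ → ℝ → ℝ) : Prop where
  meas : Measurable fun p : ℝ × ℝ => a p.1 p.2
  bdd : ∃ C : ℝ, ∀ x s, |a x s| ≤ C * Real.exp (k * (1 - x))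

/-- Integral operator of a transport equation, with datum `p` at `x = 1`. -/
noncomputable def marchOp (p : ℝ → ℝ) (H : ℝ → ℝ → ℝ → ℝ → ℝ) (σ₁ σ₂ : ℝ → ℝ)
    (a b : ℝ → ℝ → ℝ) (x s : ℝ) : ℝ :=
  (Icc (0 : ℝ) 1).indicator
    (fun x => p s + ∫ ξ in Ioc x 1, H ξ s (a ξ (s + σ₁ ξ)) (b ξ (s + σ₂ ξ))) x

section Picard

variable {K k M : ℝ} {p : ℝ → ℝ} {H : ℝ → ℝ → ℝ → ℝ → ℝ} {σ₁ σ₂ : ℝ → ℝ}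
  {a b a' b' : ℝ → ℝ → ℝ}

theorem IsMarchKernel.measurable_comp (hH : IsMarchKernel K H) (h₁ : Measurable σ₁)
    (h₂ : Measurable σ₂) (ha : IsMarchFn k a) (hb : IsMarchFn k b) :
    Measurable fun q : ℝ × ℝ => H q.1 q.2 (a q.1 (q.2 + σ₁ q.1)) (b q.1 (q.2 + σ₂ q.1)) := by
  have ma : Measurable fun q : ℝ × ℝ => a q.1 (q.2 + σ₁ q.1) :=
    ha.meas.comp (measurable_fst.prodMk (by fun_prop : Measurable fun q : ℝ × ℝ => q.2 + σ₁ q.1))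
  have mb : Measurable fun q : ℝ × ℝ => b q.1 (q.2 + σ₂ q.1) :=
    hb.meas.comp (measurable_fst.prodMk (by fun_prop : Measurable fun q : ℝ × ℝ => q.2 + σ₂ q.1))
  exact hH.meas.comp (measurable_fst.prodMk (measurable_snd.prodMk (ma.prodMk mb)))

theorem integrableOn_exp_weight (k C x : ℝ) :
    IntegrableOn (fun ξ => C * Real.exp (k * (1 - ξ))) (Ioc x 1) :=
  ((by fun_prop : Continuous fun ξ : ℝ => C * Real.exp (k * (1 - ξ))).integrableOn_Icc).mono_set
    Ioc_subset_Icc_self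

theorem IsMarchKernel.integrableOn_comp (hH : IsMarchKernel K H) (h₁ : Measurable σ₁)
    (h₂ : Measurable σ₂) (ha : IsMarchFn k a) (hb : IsMarchFn k b) (x s : ℝ) :
    IntegrableOn (fun ξ => H ξ s (a ξ (s + σ₁ ξ)) (b ξ (s + σ₂ ξ))) (Ioc x 1) := by
  obtain ⟨A, hA⟩ := ha.bdd
  obtain ⟨B, hB⟩ := hb.bdd
  refine Integrable.mono' (integrableOn_exp_weight k (K * max A B) x) ?_
    (Filter.Eventually.of_forall fun ξ => ?_)
  · exact ((hH.measurable_comp h₁ h₂ ha hb).comp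
      (measurable_id.prodMk measurable_const)).aestronglyMeasurable
  · have h := hH.lip ξ s (a ξ (s + σ₁ ξ)) (b ξ (s + σ₂ ξ)) 0 0
    rw [hH.zero, sub_zero, sub_zero, sub_zero] at h
    rw [Real.norm_eq_abs, mul_assoc]
    refine h.trans (mul_le_mul_of_nonneg_left (max_le ?_ ?_) hH.nonneg)
    · exact (hA _ _).trans (mul_le_mul_of_nonneg_right (le_max_left _ _) (Real.exp_pos _).le)
    · exact (hB _ _).trans (mul_le_mul_of_nonneg_right (le_max_right _ _) (Real.exp_pos _).le)

/-- The weight turns the Volterra operator into a contraction on all of `[0, 1]` at once: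
integrating it over `(x, 1]` costs a factor `1 / k`, and `K / k ≤ 1/2`. -/
theorem IsMarchKernel.abs_marchOp_sub_le (hH : IsMarchKernel K H) (hk : 0 < k) (hKk : 2 * K ≤ k)
    (h₁ : Measurable σ₁) (h₂ : Measurable σ₂) (ha : IsMarchFn k a) (hb : IsMarchFn k b)
    (ha' : IsMarchFn k a') (hb' : IsMarchFn k b') {D : ℝ} (hD : 0 ≤ D)
    (hda : ∀ x s, |a x s - a' x s| ≤ D * Real.exp (k * (1 - x)))
    (hdb : ∀ x s, |b x s - b' x s| ≤ D * Real.exp (k * (1 - x))) (x s : ℝ) :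
    |marchOp p H σ₁ σ₂ a b x s - marchOp p H σ₁ σ₂ a' b' x s| ≤
      D / 2 * Real.exp (k * (1 - x)) := by
  by_cases hx : x ∈ Icc (0 : ℝ) 1
  · rw [marchOp, marchOp, indicator_of_mem hx, indicator_of_mem hx, add_sub_add_left_eq_sub,
      ← integral_sub (hH.integrableOn_comp h₁ h₂ ha hb x s)
        (hH.integrableOn_comp h₁ h₂ ha' hb' x s)]
    have hn := norm_integral_le_of_norm_le (integrableOn_exp_weight k (K * D) x)
      (f := fun ξ => H ξ s (a ξ (s + σ₁ ξ)) (b ξ (s + σ₂ ξ)) -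
        H ξ s (a' ξ (s + σ₁ ξ)) (b' ξ (s + σ₂ ξ)))
      (Filter.Eventually.of_forall fun ξ => by
        rw [Real.norm_eq_abs, mul_assoc]
        exact (hH.lip _ _ _ _ _ _).trans
          (mul_le_mul_of_nonneg_left (max_le (hda _ _) (hdb _ _)) hH.nonneg))
    rw [Real.norm_eq_abs] at hn
    refine hn.trans ?_
    rw [integral_const_mul]
    refine (mul_le_mul_of_nonneg_left (integral_exp_weight_le hk hx.2)
      (mul_nonneg hH.nonneg hD)).trans ?_
    have hKk' : K / k ≤ 1 / 2 := by
      rw [div_le_iff₀ hk]; linarith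
    have h0 : 0 ≤ D * Real.exp (k * (1 - x)) := by positivity
    calc K * D * (Real.exp (k * (1 - x)) / k) = K / k * (D * Real.exp (k * (1 - x))) := by ring
      _ ≤ 1 / 2 * (D * Real.exp (k * (1 - x))) := by gcongr
      _ = _ := by ring
  · rw [marchOp, marchOp, indicator_of_notMem hx, indicator_of_notMem hx, sub_zero, abs_zero]
    positivity

theorem isMarchFn_zero (k : ℝ) : IsMarchFn k fun _ _ => 0 :=
  ⟨measurable_const, 0, fun _ _ => by simp⟩

theorem IsMarchKernel.abs_marchOp_zero_le (hH : IsMarchKernel K H) (hk : 0 < k) (hM : 0 ≤ M)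
    (hp : ∀ s, |p s| ≤ M) (x s : ℝ) :
    |marchOp p H σ₁ σ₂ (fun _ _ => 0) (fun _ _ => 0) x s| ≤ M * Real.exp (k * (1 - x)) := by
  by_cases hx : x ∈ Icc (0 : ℝ) 1
  · rw [marchOp, indicator_of_mem hx]
    simp only [hH.zero, integral_zero, add_zero]
    refine (hp s).trans (le_mul_of_one_le_right hM ?_)
    exact Real.one_le_exp (mul_nonneg hk.le (by linarith [hx.2]))
  · rw [marchOp, indicator_of_notMem hx, abs_zero]
    positivity

theorem IsMarchKernel.isMarchFn_marchOp (hH : IsMarchKernel K H) (hk : 0 < k) (hKk : 2 * K ≤ k)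
    (h₁ : Measurable σ₁) (h₂ : Measurable σ₂) (hpm : Measurable p) (hp : ∀ s, |p s| ≤ M)
    (ha : IsMarchFn k a) (hb : IsMarchFn k b) : IsMarchFn k (marchOp p H σ₁ σ₂ a b) := by
  constructor
  · have hc := hH.measurable_comp h₁ h₂ ha hb
    have hint : Measurable fun q : ℝ × ℝ =>
        ∫ ξ in Ioc q.1 1, H ξ q.2 (a ξ (q.2 + σ₁ ξ)) (b ξ (q.2 + σ₂ ξ)) := by
      -- The moving domain `Ioc q.1 1` becomes an indicator in three variables, so measurability of
      -- parametric integrals applies.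
      have hs : MeasurableSet {r : (ℝ × ℝ) × ℝ | r.2 ∈ Ioc r.1.1 1} :=
        (measurableSet_lt (f := fun r : (ℝ × ℝ) × ℝ => r.1.1) (by fun_prop) measurable_snd).inter
          (measurableSet_le measurable_snd measurable_const)
      have hm : Measurable ({r : (ℝ × ℝ) × ℝ | r.2 ∈ Ioc r.1.1 1}.indicator fun r =>
          H r.2 r.1.2 (a r.2 (r.1.2 + σ₁ r.2)) (b r.2 (r.1.2 + σ₂ r.2))) :=
        (hc.comp (measurable_snd.prodMk measurable_fst.snd)).indicator hs
      have := hm.stronglyMeasurable.integral_prod_right' (ν := (volume : Measure ℝ))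
      convert this.measurable using 1
      funext q
      rw [← integral_indicator measurableSet_Ioc]
      rfl
    have h3 : Measurable fun q : ℝ × ℝ =>
        p q.2 + ∫ ξ in Ioc q.1 1, H ξ q.2 (a ξ (q.2 + σ₁ ξ)) (b ξ (q.2 + σ₂ ξ)) :=
      (hpm.comp measurable_snd).add hint
    exact h3.indicator (measurable_fst (measurableSet_Icc (a := (0 : ℝ)) (b := 1)))
  · obtain ⟨A, hA⟩ := ha.bdd
    obtain ⟨B, hB⟩ := hb.bdd
    have hM : 0 ≤ M := (abs_nonneg _).trans (hp 0)
    set D := max 0 (max A B)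
    have hD : 0 ≤ D := le_max_left _ _
    refine ⟨D / 2 + M, fun x s => ?_⟩
    have e1 := hH.abs_marchOp_sub_le (p := p) hk hKk h₁ h₂ ha hb (isMarchFn_zero k)
      (isMarchFn_zero k) hD
      (fun x s => by
        rw [sub_zero]
        exact (hA x s).trans (mul_le_mul_of_nonneg_right
          ((le_max_left _ _).trans (le_max_right _ _)) (Real.exp_pos _).le))
      (fun x s => by
        rw [sub_zero]
        exact (hB x s).trans (mul_le_mul_of_nonneg_right
          ((le_max_right _ _).trans (le_max_right _ _)) (Real.exp_pos _).le)) x s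
    have e2 := hH.abs_marchOp_zero_le (σ₁ := σ₁) (σ₂ := σ₂) hk hM hp x s
    have e3 := abs_sub_abs_le_abs_sub (marchOp p H σ₁ σ₂ a b x s)
      (marchOp p H σ₁ σ₂ (fun _ _ => 0) (fun _ _ => 0) x s)
    rw [add_mul]
    linarith

end Picard

/-- Existence of bounded measurable solutions of a pair of integral equations, valid everywhere. -/
theorem exists_marchOp_fixedPoint {K M : ℝ} {p₁ p₂ : ℝ → ℝ} {H₁ H₂ : ℝ → ℝ → ℝ → ℝ → ℝ}
    {σ₁ σ₂ ρ₁ ρ₂ : ℝ → ℝ} (hH₁ : IsMarchKernel K H₁) (hH₂ : IsMarchKernel K H₂)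
    (hσ₁ : Measurable σ₁) (hσ₂ : Measurable σ₂) (hρ₁ : Measurable ρ₁) (hρ₂ : Measurable ρ₂)
    (hpm₁ : Measurable p₁) (hpm₂ : Measurable p₂) (hp₁ : ∀ s, |p₁ s| ≤ M)
    (hp₂ : ∀ s, |p₂ s| ≤ M) :
    ∃ a b : ℝ → ℝ → ℝ, Measurable (fun q : ℝ × ℝ => a q.1 q.2) ∧
      Measurable (fun q : ℝ × ℝ => b q.1 q.2) ∧
      (∃ C : ℝ, ∀ x ∈ Icc (0 : ℝ) 1, ∀ s, |a x s| ≤ C ∧ |b x s| ≤ C) ∧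
      ∀ x ∈ Icc (0 : ℝ) 1, ∀ s,
        a x s = p₁ s + ∫ ξ in Ioc x 1, H₁ ξ s (a ξ (s + σ₁ ξ)) (b ξ (s + σ₂ ξ)) ∧
        b x s = p₂ s + ∫ ξ in Ioc x 1, H₂ ξ s (a ξ (s + ρ₁ ξ)) (b ξ (s + ρ₂ ξ)) := by
  set k : ℝ := 2 * K + 1 with hk
  have hk0 : 0 < k := by linarith [hH₁.nonneg]
  have hKk : 2 * K ≤ k := by linarith
  have hM : 0 ≤ M := (abs_nonneg _).trans (hp₁ 0)
  let Φ : (ℝ → ℝ → ℝ) × (ℝ → ℝ → ℝ) → (ℝ → ℝ → ℝ) × (ℝ → ℝ → ℝ) := fun w =>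
    (marchOp p₁ H₁ σ₁ σ₂ w.1 w.2, marchOp p₂ H₂ ρ₁ ρ₂ w.1 w.2)
  let w : ℕ → (ℝ → ℝ → ℝ) × (ℝ → ℝ → ℝ) := fun m => Φ^[m] (fun _ _ => 0, fun _ _ => 0)
  have hsucc : ∀ m, w (m + 1) = Φ (w m) := fun m => Function.iterate_succ_apply' _ _ _
  have hnice : ∀ m, IsMarchFn k (w m).1 ∧ IsMarchFn k (w m).2 := by
    intro m
    induction m with
    | zero => exact ⟨isMarchFn_zero k, isMarchFn_zero k⟩
    | succ m ih =>
      rw [hsucc]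
      exact ⟨hH₁.isMarchFn_marchOp hk0 hKk hσ₁ hσ₂ hpm₁ hp₁ ih.1 ih.2,
        hH₂.isMarchFn_marchOp hk0 hKk hρ₁ hρ₂ hpm₂ hp₂ ih.1 ih.2⟩
  have hstep : ∀ m, ∀ x s,
      |(w m).1 x s - (w (m + 1)).1 x s| ≤ M * Real.exp (k * (1 - x)) * (1 / 2) ^ m ∧
      |(w m).2 x s - (w (m + 1)).2 x s| ≤ M * Real.exp (k * (1 - x)) * (1 / 2) ^ m := by
    intro m
    induction m with
    | zero =>
      intro x s
      rw [hsucc, pow_zero, mul_one]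
      change |0 - _| ≤ _ ∧ |0 - _| ≤ _
      rw [zero_sub, zero_sub, abs_neg, abs_neg]
      exact ⟨hH₁.abs_marchOp_zero_le (σ₁ := σ₁) (σ₂ := σ₂) hk0 hM hp₁ x s,
        hH₂.abs_marchOp_zero_le (σ₁ := ρ₁) (σ₂ := ρ₂) hk0 hM hp₂ x s⟩
    | succ m ih =>
      intro x s
      have hD : 0 ≤ M * (1 / 2 : ℝ) ^ m := by positivity
      have e1 : ∀ x s, |(w m).1 x s - (w (m + 1)).1 x s| ≤
          M * (1 / 2 : ℝ) ^ m * Real.exp (k * (1 - x)) := fun x s => by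
        rw [mul_right_comm]; exact (ih x s).1
      have e2 : ∀ x s, |(w m).2 x s - (w (m + 1)).2 x s| ≤
          M * (1 / 2 : ℝ) ^ m * Real.exp (k * (1 - x)) := fun x s => by
        rw [mul_right_comm]; exact (ih x s).2
      have f1 := hH₁.abs_marchOp_sub_le (p := p₁) hk0 hKk hσ₁ hσ₂ (hnice m).1 (hnice m).2
        (hnice (m + 1)).1 (hnice (m + 1)).2 hD e1 e2 x s
      have f2 := hH₂.abs_marchOp_sub_le (p := p₂) hk0 hKk hρ₁ hρ₂ (hnice m).1 (hnice m).2
        (hnice (m + 1)).1 (hnice (m + 1)).2 hD e1 e2 x s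
      have hw1 := hsucc m
      have hw2 := hsucc (m + 1)
      rw [show M * Real.exp (k * (1 - x)) * (1 / 2 : ℝ) ^ (m + 1) =
        M * (1 / 2 : ℝ) ^ m / 2 * Real.exp (k * (1 - x)) by ring, hw2]
      nth_rewrite 1 [hw1]
      nth_rewrite 2 [hw1]
      exact ⟨f1, f2⟩
  -- Limits are taken at every point, so the integral equations hold everywhere, not merely almost
  -- everywhere.
  have hlim1 : ∀ x s, ∃ l, Filter.Tendsto (fun m => (w m).1 x s) Filter.atTop (nhds l) :=
    fun x s => cauchySeq_tendsto_of_complete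
      (cauchySeq_of_le_geometric (1 / 2) _ (by norm_num) fun m => (hstep m x s).1)
  have hlim2 : ∀ x s, ∃ l, Filter.Tendsto (fun m => (w m).2 x s) Filter.atTop (nhds l) :=
    fun x s => cauchySeq_tendsto_of_complete
      (cauchySeq_of_le_geometric (1 / 2) _ (by norm_num) fun m => (hstep m x s).2)
  choose a ha using hlim1
  choose b hb using hlim2
  have hda : ∀ m x s, |(w m).1 x s - a x s| ≤ 2 * M * (1 / 2) ^ m * Real.exp (k * (1 - x)) := by
    intro m x s
    refine (dist_le_of_le_geometric_of_tendsto (1 / 2) _ (by norm_num)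
      (fun m => (hstep m x s).1) (ha x s) m).trans_eq ?_
    ring
  have hdb : ∀ m x s, |(w m).2 x s - b x s| ≤ 2 * M * (1 / 2) ^ m * Real.exp (k * (1 - x)) := by
    intro m x s
    refine (dist_le_of_le_geometric_of_tendsto (1 / 2) _ (by norm_num)
      (fun m => (hstep m x s).2) (hb x s) m).trans_eq ?_
    ring
  have hba : ∀ x s, |a x s| ≤ 2 * M * Real.exp (k * (1 - x)) := fun x s => by
    have : |0 - a x s| ≤ _ := hda 0 x s
    simpa using this
  have hbb : ∀ x s, |b x s| ≤ 2 * M * Real.exp (k * (1 - x)) := fun x s => by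
    have : |0 - b x s| ≤ _ := hdb 0 x s
    simpa using this
  have hma : Measurable fun q : ℝ × ℝ => a q.1 q.2 :=
    measurable_of_tendsto_metrizable (fun m => (hnice m).1.meas)
      (tendsto_pi_nhds.2 fun q => ha q.1 q.2)
  have hmb : Measurable fun q : ℝ × ℝ => b q.1 q.2 :=
    measurable_of_tendsto_metrizable (fun m => (hnice m).2.meas)
      (tendsto_pi_nhds.2 fun q => hb q.1 q.2)
  have hfa : IsMarchFn k a := ⟨hma, 2 * M, hba⟩
  have hfb : IsMarchFn k b := ⟨hmb, 2 * M, hbb⟩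
  have hgeo : ∀ x : ℝ, Filter.Tendsto (fun m : ℕ => 2 * M * (1 / 2 : ℝ) ^ m / 2 *
      Real.exp (k * (1 - x))) Filter.atTop (nhds 0) := fun x => by
    simpa using (((tendsto_pow_atTop_nhds_zero_of_lt_one (by norm_num)
      (by norm_num : (1 / 2 : ℝ) < 1)).const_mul (2 * M)).div_const 2).mul_const
        (Real.exp (k * (1 - x)))
  refine ⟨a, b, hma, hmb, ⟨2 * M * Real.exp k, fun x hx s => ?_⟩, fun x hx s => ?_⟩
  · have : Real.exp (k * (1 - x)) ≤ Real.exp k :=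
      Real.exp_le_exp.2 (mul_le_of_le_one_right hk0.le (by linarith [hx.1]))
    exact ⟨(hba x s).trans (by gcongr), (hbb x s).trans (by gcongr)⟩
  · constructor
    · have h1 : Filter.Tendsto (fun m => (w (m + 1)).1 x s) Filter.atTop
          (nhds (marchOp p₁ H₁ σ₁ σ₂ a b x s)) := by
        rw [tendsto_iff_dist_tendsto_zero]
        refine squeeze_zero (fun _ => dist_nonneg) (fun m => ?_) (hgeo x)
        rw [hsucc]
        exact hH₁.abs_marchOp_sub_le hk0 hKk hσ₁ hσ₂ (hnice m).1 (hnice m).2 hfa hfb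
          (by positivity) (hda m) (hdb m) x s
      have h2 := tendsto_nhds_unique ((Filter.tendsto_add_atTop_iff_nat 1).2 (ha x s)) h1
      rw [h2, marchOp, indicator_of_mem hx]
    · have h1 : Filter.Tendsto (fun m => (w (m + 1)).2 x s) Filter.atTop
          (nhds (marchOp p₂ H₂ ρ₁ ρ₂ a b x s)) := by
        rw [tendsto_iff_dist_tendsto_zero]
        refine squeeze_zero (fun _ => dist_nonneg) (fun m => ?_) (hgeo x)
        rw [hsucc]
        exact hH₂.abs_marchOp_sub_le hk0 hKk hρ₁ hρ₂ (hnice m).1 (hnice m).2 hfa hfb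
          (by positivity) (hda m) (hdb m) x s
      have h2 := tendsto_nhds_unique ((Filter.tendsto_add_atTop_iff_nat 1).2 (hb x s)) h1
      rw [h2, marchOp, indicator_of_mem hx]

/-! ### Travel times and their inverses. -/

/-- Time needed to travel from `x` to `1` with slowness `r`; the slowness is cut off outside
`[0, 1]`. -/
noncomputable def tailTime (r : ℝ → ℝ) (x : ℝ) : ℝ :=
  ∫ ξ in x..(1 : ℝ), (Icc (0 : ℝ) 1).indicator r ξ

/-- Slowness functions: measurable, positive and bounded on `[0, 1]`. -/
structure IsSlowness (r : ℝ → ℝ) : Prop where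
  meas : Measurable r
  pos : ∀ x ∈ Icc (0 : ℝ) 1, 0 < r x
  bdd : ∃ l : ℝ, ∀ x ∈ Icc (0 : ℝ) 1, r x ≤ l

section Slowness

variable {r : ℝ → ℝ}

theorem IsSlowness.integrable (hr : IsSlowness r) : Integrable ((Icc (0 : ℝ) 1).indicator r) := by
  obtain ⟨l, hl⟩ := hr.bdd
  rw [integrable_indicator_iff measurableSet_Icc]
  refine Measure.integrableOn_of_bounded (M := l) (by simp) hr.meas.aestronglyMeasurable ?_
  refine (ae_restrict_mem measurableSet_Icc).mono fun x hx => ?_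
  rw [Real.norm_eq_abs, abs_of_pos (hr.pos x hx)]
  exact hl x hx

/-- The cut-off makes the slowness integrable on the whole line, although nothing bounds it outside
`[0, 1]`. -/
theorem IsSlowness.continuous_tailTime (hr : IsSlowness r) : Continuous (tailTime r) := by
  have h : tailTime r = fun x => -∫ ξ in (1 : ℝ)..x, (Icc (0 : ℝ) 1).indicator r ξ :=
    funext fun x => intervalIntegral.integral_symm _ _
  rw [h]
  exact (intervalIntegral.continuous_primitive
    (fun _ _ => hr.integrable.intervalIntegrable) _).neg

theorem tailTime_one (r : ℝ → ℝ) : tailTime r 1 = 0 := intervalIntegral.integral_same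

theorem IsSlowness.integral_eq (hr : IsSlowness r) {x y : ℝ} (hx : x ∈ Icc (0 : ℝ) 1)
    (hy : y ∈ Icc (0 : ℝ) 1) : ∫ ξ in x..y, r ξ = tailTime r x - tailTime r y := by
  rw [tailTime, tailTime, ← intervalIntegral.integral_add_adjacent_intervals
    (hr.integrable.intervalIntegrable (a := x) (b := y)) hr.integrable.intervalIntegrable,
    add_sub_cancel_right]
  refine intervalIntegral.integral_congr fun ξ hξ => ?_
  exact (indicator_of_mem (uIcc_subset_Icc hx hy hξ) r).symm

theorem IsSlowness.strictAntiOn_tailTime (hr : IsSlowness r) :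
    StrictAntiOn (tailTime r) (Icc 0 1) := by
  intro x hx y hy hxy
  rw [← sub_pos, ← hr.integral_eq hx hy]
  refine intervalIntegral.intervalIntegral_pos_of_pos_on ?_ (fun ξ hξ => ?_) hxy
  · have h := hr.integrable.intervalIntegrable (a := x) (b := y)
    refine h.congr fun ξ hξ => ?_
    exact indicator_of_mem (uIcc_subset_Icc hx hy (uIoc_subset_uIcc hξ)) r
  · exact hr.pos ξ ⟨hx.1.trans hξ.1.le, hξ.2.le.trans hy.2⟩

theorem IsSlowness.tailTime_nonneg (hr : IsSlowness r) {x : ℝ} (hx : x ∈ Icc (0 : ℝ) 1) :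
    0 ≤ tailTime r x :=
  tailTime_one r ▸ hr.strictAntiOn_tailTime.antitoneOn hx (right_mem_Icc.2 zero_le_one) hx.2

theorem IsSlowness.tailTime_le (hr : IsSlowness r) {x : ℝ} (hx : x ∈ Icc (0 : ℝ) 1) :
    tailTime r x ≤ tailTime r 0 :=
  hr.strictAntiOn_tailTime.antitoneOn (left_mem_Icc.2 zero_le_one) hx hx.1

/-- Left inverse of `tailTime` on `[0, 1]`. -/
noncomputable def tailPos (r : ℝ → ℝ) (s : ℝ) : ℝ := sSup {y ∈ Icc (0 : ℝ) 1 | s ≤ tailTime r y}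

/-- Raising `s` shrinks the set, so the supremum decreases. Once the set is empty the default value
`0` still respects this order. -/
theorem measurable_tailPos (r : ℝ → ℝ) : Measurable (tailPos r) := by
  have : Antitone (tailPos r) := by
    intro s s' h
    rcases eq_empty_or_nonempty {y ∈ Icc (0 : ℝ) 1 | s' ≤ tailTime r y} with he | hne
    · rw [tailPos, he, Real.sSup_empty]
      exact Real.sSup_nonneg fun y hy => hy.1.1
    · exact csSup_le_csSup ⟨1, fun y hy => hy.1.2⟩ hne fun y hy => ⟨hy.1, h.trans hy.2⟩
  exact this.measurable

theorem IsSlowness.tailPos_tailTime (hr : IsSlowness r) {y : ℝ} (hy : y ∈ Icc (0 : ℝ) 1) :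
    tailPos r (tailTime r y) = y := by
  have : {z ∈ Icc (0 : ℝ) 1 | tailTime r y ≤ tailTime r z} = Icc 0 y := by
    ext z
    constructor
    · rintro ⟨hz, h⟩
      exact ⟨hz.1, (hr.strictAntiOn_tailTime.le_iff_ge hy hz).1 h⟩
    · rintro ⟨h0, h⟩
      have hz : z ∈ Icc (0 : ℝ) 1 := ⟨h0, h.trans hy.2⟩
      exact ⟨hz, (hr.strictAntiOn_tailTime.le_iff_ge hy hz).2 h⟩
  rw [tailPos, this, csSup_Icc hy.1]

end Slowness

theorem MemLp.exists_bounded_measurable_ae_eq {f : ℝ → ℝ} {μ : Measure ℝ} (hf : MemLp f ⊤ μ) :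
    ∃ g : ℝ → ℝ, Measurable g ∧ (∃ M : ℝ, ∀ x, |g x| ≤ M) ∧ f =ᵐ[μ] g := by
  set M := (eLpNorm f ⊤ μ).toReal
  have hM : 0 ≤ M := ENNReal.toReal_nonneg
  have hb : ∀ᵐ x ∂μ, |f x| ≤ M := by
    have h := ae_le_eLpNormEssSup (f := f) (μ := μ)
    filter_upwards [h] with x hx
    rw [← eLpNorm_exponent_top] at hx
    have h2 : ‖f x‖ₑ.toReal ≤ M := ENNReal.toReal_mono hf.2.ne hx
    rwa [toReal_enorm, Real.norm_eq_abs] at h2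
  refine ⟨fun x => max (-M) (min M (hf.1.aemeasurable.mk f x)),
    measurable_const.max (measurable_const.min hf.1.aemeasurable.measurable_mk),
    ⟨M, fun x => abs_le.2 ⟨le_max_left _ _, max_le (by linarith) (min_le_left _ _)⟩⟩, ?_⟩
  filter_upwards [hb, hf.1.aemeasurable.ae_eq_mk] with x h1 h2
  rw [← h2, min_eq_right (abs_le.1 h1).2, max_eq_right (abs_le.1 h1).1]

theorem LocallyEssBounded.integrableOn {a : ℝ → ℝ → ℝ} (ha : LocallyEssBounded a) {t0 : ℝ}
    (ht0 : 0 ≤ t0) (τ : ℝ) :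
    IntegrableOn (fun p : ℝ × ℝ => a p.1 p.2) (Icc 0 1 ×ˢ Icc t0 τ) := by
  have : IsFiniteMeasure ((volume : Measure (ℝ × ℝ)).restrict (Icc (0 : ℝ) 1 ×ˢ Icc (0 : ℝ) τ)) :=
    isFiniteMeasure_restrict.2 (isCompact_Icc.prod isCompact_Icc).measure_lt_top.ne
  exact IntegrableOn.mono_set ((ha τ).integrable le_top)
    (prod_mono_right (Icc_subset_Icc_left ht0))

/-! ### Observer and past plant state as marching solutions. -/

section Data

variable {n : ℕ} {S : System n}

theorem System.Admissible.isSlowness_lamU (hS : S.Admissible) :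
    IsSlowness fun ξ => 1 / S.lamU ξ := by
  obtain ⟨l, hl⟩ := hS.inv_speed_le
  exact ⟨measurable_const.div hS.meas_lamU, fun x hx => one_div_pos.2 (hS.lamU_pos x hx),
    l, fun x hx => by rw [one_div]; exact (le_max_left _ _).trans (hl x hx)⟩

theorem System.Admissible.isSlowness_lamV (hS : S.Admissible) :
    IsSlowness fun ξ => 1 / S.lamV ξ := by
  obtain ⟨l, hl⟩ := hS.inv_speed_le
  exact ⟨measurable_const.div hS.meas_lamV, fun x hx => one_div_pos.2 (hS.lamV_pos x hx),
    l, fun x hx => by rw [one_div]; exact (le_max_right _ _).trans (hl x hx)⟩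

theorem System.Admissible.one_div_muHat (hS : S.Admissible) {x : ℝ} (hx : x ∈ Icc (0 : ℝ) 1) :
    1 / S.muHat x = 1 / S.lamU x + 1 / S.lamV x := by
  have h1 := hS.lamU_pos x hx
  have h2 := hS.lamV_pos x hx
  rw [System.muHat, System.nuHat]
  field_simp
  ring

theorem System.Admissible.nuHat_mul_div_muHat (hS : S.Admissible) {x : ℝ}
    (hx : x ∈ Icc (0 : ℝ) 1) (c : ℝ) : S.nuHat x * c / S.muHat x = c / S.lamV x := by
  have h1 := hS.lamU_pos x hx
  have h2 := hS.lamV_pos x hx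
  rw [System.muHat, System.nuHat]
  field_simp

theorem System.Admissible.isSlowness_muHat (hS : S.Admissible) :
    IsSlowness fun ξ => 1 / S.muHat ξ := by
  obtain ⟨l, hl⟩ := hS.isSlowness_lamU.bdd
  obtain ⟨l', hl'⟩ := hS.isSlowness_lamV.bdd
  refine ⟨measurable_const.div
    (hS.meas_lamV.mul (hS.meas_lamU.div (hS.meas_lamU.add hS.meas_lamV))),
    fun x hx => ?_, l + l', fun x hx => ?_⟩
  · simp only [hS.one_div_muHat hx]
    exact add_pos (hS.isSlowness_lamU.pos x hx) (hS.isSlowness_lamV.pos x hx)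
  · simp only [hS.one_div_muHat hx]
    exact add_le_add (hl x hx) (hl' x hx)

/-- Travel times to `x = 1`. -/
noncomputable def System.timeU (S : System n) : ℝ → ℝ := tailTime fun ξ => 1 / S.lamU ξ

noncomputable def System.timeV (S : System n) : ℝ → ℝ := tailTime fun ξ => 1 / S.lamV ξ

noncomputable def System.timeHat (S : System n) : ℝ → ℝ := tailTime fun ξ => 1 / S.muHat ξ

/-- This is what makes the choice of `muHat` work: sampling at `θ + timeHat x`, delayed by `timeU
x`, lands at `θ + timeV x`, on the plant's own `v`-characteristic. -/
theorem System.Admissible.timeHat_eq (hS : S.Admissible) {x : ℝ} (hx : x ∈ Icc (0 : ℝ) 1) :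
    S.timeHat x = S.timeU x + S.timeV x := by
  have h1 : (1 : ℝ) ∈ Icc (0 : ℝ) 1 := right_mem_Icc.2 zero_le_one
  rw [System.timeHat, System.timeU, System.timeV, tailTime, tailTime, tailTime,
    ← intervalIntegral.integral_add hS.isSlowness_lamU.integrable.intervalIntegrable
      hS.isSlowness_lamV.integrable.intervalIntegrable]
  refine intervalIntegral.integral_congr fun ξ hξ => ?_
  have hm : ξ ∈ Icc (0 : ℝ) 1 := uIcc_subset_Icc hx h1 hξ
  simp only [indicator_of_mem hm]
  exact hS.one_div_muHat hm

theorem System.Admissible.tauCheck_eq (hS : S.Admissible) {x : ℝ} (hx : x ∈ Icc (0 : ℝ) 1)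
    (t : ℝ) : S.tauCheck t x = t - S.timeU x := by
  rw [System.tauCheck, hS.isSlowness_lamU.integral_eq hx (right_mem_Icc.2 zero_le_one),
    tailTime_one, sub_zero, System.timeU]

theorem System.Admissible.charU_eq (hS : S.Admissible) {x : ℝ} (hx : x ∈ Icc (0 : ℝ) 1)
    (t : ℝ) : S.charU 0 t x = t + S.timeU 0 - S.timeU x := by
  rw [System.charU, hS.isSlowness_lamU.integral_eq (left_mem_Icc.2 zero_le_one) hx,
    System.timeU, add_sub_assoc]

theorem System.Admissible.charV_eq (hS : S.Admissible) {x : ℝ} (hx : x ∈ Icc (0 : ℝ) 1)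
    (t : ℝ) : S.charV 1 t x = t + S.timeV x := by
  rw [System.charV, hS.isSlowness_lamV.integral_eq hx (right_mem_Icc.2 zero_le_one),
    tailTime_one, sub_zero, System.timeV]

theorem System.Admissible.charHat_eq (hS : S.Admissible) {x y : ℝ} (hx : x ∈ Icc (0 : ℝ) 1)
    (hy : y ∈ Icc (0 : ℝ) 1) (t : ℝ) : S.charHat y t x = t + (S.timeHat x - S.timeHat y) := by
  rw [System.charHat, hS.isSlowness_muHat.integral_eq hx hy, System.timeHat]

theorem System.Admissible.charHat_one_eq (hS : S.Admissible) {x : ℝ} (hx : x ∈ Icc (0 : ℝ) 1)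
    (t : ℝ) : S.charHat 1 t x = t + S.timeHat x := by
  rw [hS.charHat_eq hx (right_mem_Icc.2 zero_le_one), System.timeHat, tailTime_one, sub_zero]

/-- Source terms per unit length, cut off outside `[0, 1]`. -/
noncomputable def System.srcU (S : System n) (x a b : ℝ) : ℝ :=
  (Icc (0 : ℝ) 1).indicator (fun ξ => S.fU ξ a b / S.lamU ξ) x

noncomputable def System.srcV (S : System n) (x a b : ℝ) : ℝ :=
  (Icc (0 : ℝ) 1).indicator (fun ξ => S.fV ξ a b / S.lamV ξ) x

theorem isLipSource_indicator_div {f : ℝ → ℝ → ℝ → ℝ} {lam : ℝ → ℝ} {L l : ℝ} (hL : 0 ≤ L)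
    (hl0 : 0 ≤ l) (hf : ∀ a b, Measurable fun x => f x a b) (hlam : Measurable lam)
    (hlip : ∀ x ∈ Icc (0 : ℝ) 1, ∀ a b a' b', |f x a b - f x a' b'| ≤ L * max |a - a'| |b - b'|)
    (hzero : ∀ x ∈ Icc (0 : ℝ) 1, f x 0 0 = 0) (hpos : ∀ x ∈ Icc (0 : ℝ) 1, 0 < lam x)
    (hl : ∀ x ∈ Icc (0 : ℝ) 1, (lam x)⁻¹ ≤ l) :
    IsLipSource (L * l) fun x a b => (Icc (0 : ℝ) 1).indicator (fun ξ => f ξ a b / lam ξ) x := by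
  refine ⟨mul_nonneg hL hl0, fun a b => ((hf a b).div hlam).indicator measurableSet_Icc,
    fun x a b a' b' => ?_, fun x => ?_⟩
  · by_cases hx : x ∈ Icc (0 : ℝ) 1
    · simp only [indicator_of_mem hx]
      rw [← sub_div, div_eq_mul_inv, abs_mul, abs_of_pos (inv_pos.2 (hpos x hx)),
        mul_right_comm]
      exact mul_le_mul (hlip x hx a b a' b') (hl x hx) (inv_pos.2 (hpos x hx)).le
        (mul_nonneg hL ((abs_nonneg _).trans (le_max_left _ _)))
    · simp only [indicator_of_notMem hx, sub_zero, abs_zero]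
      exact mul_nonneg (mul_nonneg hL hl0) ((abs_nonneg _).trans (le_max_left _ _))
  · by_cases hx : x ∈ Icc (0 : ℝ) 1
    · simp only [indicator_of_mem hx, hzero x hx, zero_div]
    · simp only [indicator_of_notMem hx]

theorem System.Admissible.exists_isLipSource (hS : S.Admissible) :
    ∃ K : ℝ, IsLipSource K S.srcU ∧ IsLipSource K S.srcV := by
  obtain ⟨l, hl⟩ := hS.inv_speed_le
  obtain ⟨L, hL⟩ := hS.lip_F
  have h0 : (0 : ℝ) ∈ Icc (0 : ℝ) 1 := left_mem_Icc.2 zero_le_one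
  have hl0 : 0 ≤ l :=
    (inv_pos.2 (hS.lamU_pos 0 h0)).le.trans ((le_max_left _ _).trans (hl 0 h0))
  have hmono : ∀ a b a' b' : ℝ, L * max |a - a'| |b - b'| ≤ max 0 L * max |a - a'| |b - b'| :=
    fun a b a' b' => mul_le_mul_of_nonneg_right (le_max_right _ _)
      ((abs_nonneg _).trans (le_max_left _ _))
  exact ⟨max 0 L * l,
    isLipSource_indicator_div (le_max_left _ _) hl0 hS.meas_fU hS.meas_lamU
      (fun x hx a b a' b' => (hL x hx a b a' b').1.trans (hmono _ _ _ _))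
      (fun x hx => (hS.F_zero x hx).1) hS.lamU_pos
      (fun x hx => (le_max_left _ _).trans (hl x hx)),
    isLipSource_indicator_div (le_max_left _ _) hl0 hS.meas_fV hS.meas_lamV
      (fun x hx a b a' b' => (hL x hx a b a' b').2.trans (hmono _ _ _ _))
      (fun x hx => (hS.F_zero x hx).2) hS.lamV_pos
      (fun x hx => (le_max_right _ _).trans (hl x hx))⟩

theorem System.srcU_of_mem {x : ℝ} (hx : x ∈ Icc (0 : ℝ) 1) (a b : ℝ) :
    S.srcU x a b = S.fU x a b / S.lamU x := indicator_of_mem hx _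

theorem System.srcV_of_mem {x : ℝ} (hx : x ∈ Icc (0 : ℝ) 1) (a b : ℝ) :
    S.srcV x a b = S.fV x a b / S.lamV x := indicator_of_mem hx _

theorem intervalIntegral_eq_setIntegral_of_eqOn {f g : ℝ → ℝ} {x y : ℝ}
    (hx : x ∈ Icc (0 : ℝ) 1) (hy : y ∈ Icc (0 : ℝ) 1) (hxy : x ≤ y)
    (h : ∀ ξ ∈ Icc (0 : ℝ) 1, f ξ = g ξ) :
    ∫ ξ in x..y, f ξ = ∫ ξ in Ioc x y, g ξ := by
  rw [intervalIntegral.integral_of_le hxy]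
  exact setIntegral_congr_fun measurableSet_Ioc fun ξ hξ =>
    h ξ ⟨hx.1.trans hξ.1.le, hξ.2.trans hy.2⟩

/-- Every solution of the observer is a marching solution. -/
theorem System.IsPDEObserver.isMarching (hS : S.Admissible) {Y U uh0 vh0 : ℝ → ℝ}
    {uh vh : ℝ → ℝ → ℝ} (h : S.IsPDEObserver Y U uh0 vh0 uh vh) {t0 : ℝ} (ht0 : 0 ≤ t0) :
    IsMarching S.srcU S.srcV S.timeHat t0 Y U uh vh := by
  have h1 : (1 : ℝ) ∈ Icc (0 : ℝ) 1 := right_mem_Icc.2 zero_le_one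
  refine ⟨h.bdd_u.integrableOn ht0, h.bdd_v.integrableOn ht0, ?_, ?_⟩
  · filter_upwards [h.eq_u, h.bc_u] with t e1 e2 ht x hx
    rw [e1 (ht0.trans ht) x hx, e2 (ht0.trans ht)]
    congr 1
    exact intervalIntegral_eq_setIntegral_of_eqOn hx h1 hx.2 fun ξ hξ =>
      (System.srcU_of_mem hξ _ _).symm
  · filter_upwards [h.char_v_bdry, h.bc_v] with t e1 e2 ht x hx
    rw [← hS.charHat_one_eq hx, e1 (ht0.trans ht) x hx, e2 (ht0.trans ht)]
    congr 1
    refine intervalIntegral_eq_setIntegral_of_eqOn hx h1 hx.2 fun ξ hξ => ?_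
    rw [System.srcV_of_mem hξ, hS.nuHat_mul_div_muHat hξ, hS.charHat_one_eq hξ]

theorem integrableOn_shear {a : ℝ → ℝ → ℝ} (ha : LocallyEssBounded a) {φ : ℝ → ℝ}
    (hφ : Measurable φ) (hφ0 : ∀ x ∈ Icc (0 : ℝ) 1, 0 ≤ φ x)
    {c : ℝ} (hφc : ∀ x ∈ Icc (0 : ℝ) 1, φ x ≤ c) (τ : ℝ) :
    IntegrableOn (fun p : ℝ × ℝ => a p.1 (p.2 - φ p.1)) (Icc 0 1 ×ˢ Icc c τ) := by
  have h1 := (ha.integrableOn le_rfl τ).integrable_indicator (measurableSet_Icc.prod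
    measurableSet_Icc)
  have h2 := ((measurePreserving_shear (s := fun x => -φ x)
    hφ.neg).integrable_comp_of_integrable h1).integrableOn (s := Icc (0 : ℝ) 1 ×ˢ Icc c τ)
  refine h2.congr_fun (fun p hp => ?_) (measurableSet_Icc.prod measurableSet_Icc)
  have hm : (p.1, p.2 + -φ p.1) ∈ Icc (0 : ℝ) 1 ×ˢ Icc (0 : ℝ) τ :=
    ⟨hp.1, by have := hφc _ hp.1; have := hp.2.1; simp only; linarith,
      by have := hφ0 _ hp.1; have := hp.2.2; simp only; linarith⟩
  simp only [Function.comp_apply, indicator_of_mem hm, sub_eq_add_neg]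

/-- The past state of the plant is a marching solution. -/
theorem System.IsBroadSolution.isMarching (hS : S.Admissible) {U u0 v0 : ℝ → ℝ}
    {X0 : EuclideanSpace ℝ (Fin n)} {u v : ℝ → ℝ → ℝ} {X : ℝ → EuclideanSpace ℝ (Fin n)}
    (h : S.IsBroadSolution U u0 v0 X0 u v X) {Y : ℝ → ℝ} (hY : ∀ᵐ t : ℝ, 0 ≤ t → Y t = u 1 t) :
    IsMarching S.srcU S.srcV S.timeHat (S.timeU 0) Y U
      (fun x t => u x (S.tauCheck t x)) (fun x t => v x (S.tauCheck t x)) := by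
  have h0 : (0 : ℝ) ∈ Icc (0 : ℝ) 1 := left_mem_Icc.2 zero_le_one
  have h1 : (1 : ℝ) ∈ Icc (0 : ℝ) 1 := right_mem_Icc.2 zero_le_one
  have hT0 : 0 ≤ S.timeU 0 := hS.isSlowness_lamU.tailTime_nonneg h0
  have hm : Measurable S.timeU := hS.isSlowness_lamU.continuous_tailTime.measurable
  have hnn : ∀ x ∈ Icc (0 : ℝ) 1, 0 ≤ S.timeU x := fun x hx =>
    hS.isSlowness_lamU.tailTime_nonneg hx
  have hle : ∀ x ∈ Icc (0 : ℝ) 1, S.timeU x ≤ S.timeU 0 := fun x hx =>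
    hS.isSlowness_lamU.tailTime_le hx
  obtain ⟨K, hF, -⟩ := hS.exists_isLipSource
  have hint : ∀ {a : ℝ → ℝ → ℝ}, LocallyEssBounded a → ∀ τ, IntegrableOn
      (fun p : ℝ × ℝ => a p.1 (S.tauCheck p.2 p.1)) (Icc 0 1 ×ˢ Icc (S.timeU 0) τ) := by
    intro a ha τ
    refine (integrableOn_shear ha hm hnn hle τ).congr_fun (fun p hp => ?_)
      (measurableSet_Icc.prod measurableSet_Icc)
    simp only [hS.tauCheck_eq hp.1]
  have hline : ∀ {a : ℝ → ℝ → ℝ}, LocallyEssBounded a → ∀ᵐ t : ℝ, S.timeU 0 ≤ t →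
      IntegrableOn (fun ξ => a ξ (t - S.timeU ξ)) (Icc 0 1) := by
    intro a ha
    filter_upwards [ae_integrableOn_curve (ha.integrableOn le_rfl) (s := fun ξ => -S.timeU ξ)
      hm.neg (c := 0) (fun ξ hξ => neg_nonpos.2 (hnn ξ hξ))] with t ht h0
    simpa only [sub_eq_add_neg] using ht fun ξ hξ => by linarith [hle ξ hξ]
  refine ⟨hint h.bdd_u, hint h.bdd_v, ?_, ?_⟩
  · filter_upwards [(measurePreserving_sub_right volume
      (S.timeU 0)).quasiMeasurePreserving.ae h.char_u_bdry, hY, hline h.bdd_u, hline h.bdd_v]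
      with t e1 e2 i1 i2 ht x hx
    have hsrc := hF.integrable_comp (i1 ht) (i2 ht)
    -- The plant equation starts at `x = 0`, where the line reaching `x = 1` at time `t` departs at
    -- `t - timeU 0`. Subtracting its value at `y = 1` moves the datum to the measurement `Y t`.
    have key : ∀ y ∈ Icc (0 : ℝ) 1, u y (t - S.timeU y) = u 0 (t - S.timeU 0) +
        ∫ ξ in Ioc 0 y, S.srcU ξ (u ξ (t - S.timeU ξ)) (v ξ (t - S.timeU ξ)) := by
      intro y hy
      have e := e1 (sub_nonneg.2 ht) y hy
      rw [hS.charU_eq hy, sub_add_cancel] at e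
      rw [e]
      congr 1
      refine intervalIntegral_eq_setIntegral_of_eqOn h0 hy hy.1 fun ξ hξ => ?_
      rw [System.srcU_of_mem hξ, hS.charU_eq hξ, sub_add_cancel]
    have k1 := key 1 h1
    have k2 := key x hx
    rw [show S.timeU 1 = 0 from tailTime_one _, sub_zero] at k1
    have hsplit : ∫ ξ in Ioc 0 1, S.srcU ξ (u ξ (t - S.timeU ξ)) (v ξ (t - S.timeU ξ)) =
        (∫ ξ in Ioc 0 x, S.srcU ξ (u ξ (t - S.timeU ξ)) (v ξ (t - S.timeU ξ))) +
        ∫ ξ in Ioc x 1, S.srcU ξ (u ξ (t - S.timeU ξ)) (v ξ (t - S.timeU ξ)) := by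
      rw [← Ioc_union_Ioc_eq_Ioc hx.1 hx.2]
      refine setIntegral_union (Ioc_disjoint_Ioc_of_le le_rfl) measurableSet_Ioc
        (IntegrableOn.mono_set hsrc fun ξ hξ => ⟨hξ.1.le, hξ.2.trans hx.2⟩)
        (IntegrableOn.mono_set hsrc fun ξ hξ => ⟨hx.1.trans hξ.1.le, hξ.2⟩)
    have hcong : ∫ ξ in Ioc x 1, S.srcU ξ (u ξ (S.tauCheck t ξ)) (v ξ (S.tauCheck t ξ)) =
        ∫ ξ in Ioc x 1, S.srcU ξ (u ξ (t - S.timeU ξ)) (v ξ (t - S.timeU ξ)) :=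
      setIntegral_congr_fun measurableSet_Ioc fun ξ hξ => by
        simp only [hS.tauCheck_eq (x := ξ) ⟨hx.1.trans hξ.1.le, hξ.2⟩]
    rw [hS.tauCheck_eq hx, hcong, e2 (hT0.trans ht), k1, k2, hsplit]
    ring
  · filter_upwards [h.char_v_bdry, h.bc_v] with t e1 e2 ht x hx
    have hback : ∀ ξ ∈ Icc (0 : ℝ) 1, S.tauCheck (t + S.timeHat ξ) ξ = S.charV 1 t ξ := by
      intro ξ hξ
      rw [hS.tauCheck_eq hξ, hS.charV_eq hξ, hS.timeHat_eq hξ]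
      ring
    rw [hback x hx, e1 (hT0.trans ht) x hx, e2 (hT0.trans ht)]
    congr 1
    refine intervalIntegral_eq_setIntegral_of_eqOn hx h1 hx.2 fun ξ hξ => ?_
    rw [System.srcV_of_mem hξ, hback ξ hξ]

end Data

/-! ### Existence of the PDE observer state. -/

section Existence

variable {n : ℕ} {S : System n}

theorem IsLipSource.isMarchKernel_neg {K : ℝ} {F : ℝ → ℝ → ℝ → ℝ} (hF : IsLipSource K F) :
    IsMarchKernel K fun x _ a b => -F x a b := by
  refine ⟨hF.nonneg, ?_, fun x s a b a' b' => ?_, fun x s => by simp [hF.zero]⟩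
  · exact (hF.measurable.comp
      (measurable_fst.prodMk measurable_snd.snd)).neg
  · rw [neg_sub_neg, abs_sub_comm]
    exact hF.lip x a b a' b'

/-- Here `s` labels a line and `s + ψ x` is physical time. With the source off at negative times, a
fictitious datum at `x = 1` travels unchanged until `t = 0`. -/
theorem IsLipSource.isMarchKernel_cutoff {K : ℝ} {F : ℝ → ℝ → ℝ → ℝ} (hF : IsLipSource K F)
    {ψ : ℝ → ℝ} (hψ : Measurable ψ) :
    IsMarchKernel K fun x s a b => {s | 0 ≤ s + ψ x}.indicator (fun _ => F x a b) s := by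
  refine ⟨hF.nonneg, ?_, fun x s a b a' b' => ?_, fun x s => by simp [hF.zero]⟩
  · have hs : MeasurableSet {q : ℝ × ℝ × ℝ × ℝ | 0 ≤ q.2.1 + ψ q.1} :=
      measurableSet_le measurable_const (by fun_prop)
    exact (hF.measurable.comp (measurable_fst.prodMk measurable_snd.snd)).indicator hs
  · by_cases h : s ∈ {s | 0 ≤ s + ψ x}
    · simp only [indicator_of_mem h]
      exact hF.lip x a b a' b'
    · simp only [indicator_of_notMem h, sub_zero, abs_zero]
      exact mul_nonneg hF.nonneg ((abs_nonneg _).trans (le_max_left _ _))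

theorem ae_of_ae_eq_restrict_Ici {f g : ℝ → ℝ}
    (h : f =ᵐ[volume.restrict (Ici (0 : ℝ))] g) : ∀ᵐ t : ℝ, 0 ≤ t → f t = g t :=
  (ae_restrict_iff' measurableSet_Ici).1 h

theorem memLp_top_of_abs_le {α : Type*} [MeasurableSpace α] {μ : Measure α} {f : α → ℝ}
    {s : Set α} (hs : MeasurableSet s) (hf : Measurable f) {C : ℝ} (hC : ∀ x ∈ s, |f x| ≤ C) :
    MemLp f ⊤ (μ.restrict s) :=
  memLp_top_of_bound hf.aestronglyMeasurable C ((ae_restrict_iff' hs).2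
    (Filter.Eventually.of_forall fun x hx => hC x hx))

/-- The PDE part of the observer has a solution whose trace at `x = 0` is globally bounded. -/
theorem System.Admissible.exists_isPDEObserver (hS : S.Admissible) {uh0 vh0 Y U : ℝ → ℝ}
    (hvh0 : MemLp vh0 ⊤ (volume.restrict (Icc (0 : ℝ) 1)))
    (hY : MemLp Y ⊤ (volume.restrict (Ici (0 : ℝ))))
    (hU : MemLp U ⊤ (volume.restrict (Ici (0 : ℝ)))) :
    ∃ uh vh : ℝ → ℝ → ℝ, S.IsPDEObserver Y U uh0 vh0 uh vh ∧
      Measurable (vh 0) ∧ ∃ C : ℝ, ∀ t, |vh 0 t| ≤ C := by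
  have h0 : (0 : ℝ) ∈ Icc (0 : ℝ) 1 := left_mem_Icc.2 zero_le_one
  have h1 : (1 : ℝ) ∈ Icc (0 : ℝ) 1 := right_mem_Icc.2 zero_le_one
  obtain ⟨K, hF, hG⟩ := hS.exists_isLipSource
  obtain ⟨Y', hYm, ⟨MY, hMY⟩, hYY⟩ := MemLp.exists_bounded_measurable_ae_eq hY
  obtain ⟨U', hUm, ⟨MU, hMU⟩, hUU⟩ := MemLp.exists_bounded_measurable_ae_eq hU
  obtain ⟨V', hVm, ⟨MV, hMV⟩, hVV⟩ := MemLp.exists_bounded_measurable_ae_eq hvh0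
  have hsl := hS.isSlowness_muHat
  set ψ := S.timeHat with hψdef
  have hψ : Measurable ψ := hsl.continuous_tailTime.measurable
  have hψ1 : ψ 1 = 0 := tailTime_one _
  have hanti : StrictAntiOn ψ (Icc 0 1) := hsl.strictAntiOn_tailTime
  have hψ0 : ∀ x ∈ Icc (0 : ℝ) 1, 0 ≤ ψ x := fun x hx => hsl.tailTime_nonneg hx
  -- A line with label `θ < 0` that meets `t = 0` in `[0, 1]` does so at the `y` with `ψ y = -θ`; it
  -- is given the initial value there as its datum at `x = 1`.
  let B : ℝ → ℝ := (Ici (0 : ℝ)).piecewise U' fun θ => V' (tailPos (fun ξ => 1 / S.muHat ξ) (-θ))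
  have hBm : Measurable B := Measurable.piecewise measurableSet_Ici hUm
    (hVm.comp ((measurable_tailPos _).comp measurable_neg))
  have hBpos : ∀ θ, 0 ≤ θ → B θ = U' θ := fun θ hθ => piecewise_eq_of_mem _ _ _ hθ
  have hBneg : ∀ y ∈ Icc (0 : ℝ) 1, y ≠ 1 → B (-ψ y) = V' y := by
    intro y hy hne
    have hlt : 0 < ψ y := hψ1 ▸ hanti hy h1 (lt_of_le_of_ne hy.2 hne)
    have hn : -ψ y ∉ Ici (0 : ℝ) := by
      rw [mem_Ici, not_le]; linarith
    have e : B (-ψ y) = V' (tailPos (fun ξ => 1 / S.muHat ξ) (- -ψ y)) :=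
      piecewise_eq_of_notMem _ _ _ hn
    rw [e, neg_neg, hψdef, System.timeHat, hsl.tailPos_tailTime hy]
  have hBM : ∀ θ, |B θ| ≤ max MY (max MU MV) := by
    intro θ
    by_cases hθ : θ ∈ Ici (0 : ℝ)
    · rw [hBpos θ hθ]
      exact (hMU θ).trans ((le_max_left _ _).trans (le_max_right _ _))
    · have e : B θ = V' (tailPos (fun ξ => 1 / S.muHat ξ) (-θ)) :=
        piecewise_eq_of_notMem _ _ _ hθ
      rw [e]
      exact (hMV _).trans ((le_max_right _ _).trans (le_max_right _ _))
  -- `a` is kept in physical time, `b` in the label `t - ψ x`; the shifts `-ψ` and `ψ` convert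
  -- between the two.
  obtain ⟨a, b, ham, hbm, ⟨C, hC⟩, heq⟩ := exists_marchOp_fixedPoint
    hF.isMarchKernel_neg (hG.isMarchKernel_cutoff hψ) (σ₁ := fun _ => 0) (σ₂ := fun ξ => -ψ ξ)
    (ρ₁ := ψ) (ρ₂ := fun _ => 0) measurable_const hψ.neg hψ measurable_const hYm hBm
    (fun s => (hMY s).trans (le_max_left _ _)) hBM
  simp only [add_zero] at heq
  let uh : ℝ → ℝ → ℝ := fun x t => if t = 0 then uh0 x else a x t
  let vh : ℝ → ℝ → ℝ := fun x t => b x (t - ψ x)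
  have huh : ∀ x {t : ℝ}, t ≠ 0 → uh x t = a x t := fun x t ht => if_neg ht
  have hvhm : Measurable fun p : ℝ × ℝ => vh p.1 p.2 :=
    hbm.comp (measurable_fst.prodMk (by fun_prop : Measurable fun p : ℝ × ℝ => p.2 - ψ p.1))
  have hne : ∀ᵐ t : ℝ, t ≠ 0 := Measure.ae_ne volume 0
  have hrect : ∀ τ : ℝ, MeasurableSet (Icc (0 : ℝ) 1 ×ˢ Icc (0 : ℝ) τ) := fun τ =>
    measurableSet_Icc.prod measurableSet_Icc
  have hstart : ∀ y ∈ Icc (0 : ℝ) 1, b y (-ψ y) = B (-ψ y) := by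
    intro y hy
    rw [(heq y hy _).2, setIntegral_eq_zero_of_forall_eq_zero, add_zero]
    intro ξ hξ
    refine indicator_of_notMem ?_ _
    have : ψ ξ < ψ y := hanti hy ⟨hy.1.trans hξ.1.le, hξ.2⟩ hξ.1
    simp only [mem_ofPred_eq, not_le]
    linarith
  refine ⟨uh, vh, ⟨fun τ => ?_, fun τ => ?_, ?_, ?_, ?_, ?_, ?_, ?_, ?_⟩,
    hvhm.comp (measurable_const.prodMk measurable_id), C, fun t => (hC 0 h0 _).2⟩
  · refine (memLp_top_of_abs_le (hrect τ) ham (C := C)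
      fun p hp => (hC p.1 hp.1 p.2).1).ae_eq (ae_restrict_of_ae ?_)
    have h2 : ∀ᵐ p : ℝ × ℝ, p.2 ≠ 0 := Measure.quasiMeasurePreserving_snd.ae hne
    filter_upwards [h2] with p hp
    exact (huh p.1 hp).symm
  · exact memLp_top_of_abs_le (hrect τ) hvhm fun p hp => (hC p.1 hp.1 _).2
  · filter_upwards [hne, ae_of_ae_eq_restrict_Ici hYY] with t ht e h
    rw [huh 1 ht, (heq 1 h1 t).1, Ioc_self, setIntegral_empty, add_zero, e h]
  · filter_upwards [ae_of_ae_eq_restrict_Ici hUU] with t e h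
    change b 1 (t - ψ 1) = U t
    rw [hψ1, sub_zero, (heq 1 h1 t).2, Ioc_self, setIntegral_empty, add_zero, e h, hBpos t h]
  · exact Filter.Eventually.of_forall fun x _ => if_pos rfl
  · filter_upwards [Measure.ae_ne volume 1, (ae_restrict_iff' measurableSet_Icc).1 hVV]
      with x hx e hmem
    change b x (0 - ψ x) = vh0 x
    rw [zero_sub, hstart x hmem, hBneg x hmem hx, e hmem]
  · filter_upwards [hne] with t ht _ x hx
    rw [huh x ht, huh 1 ht, (heq x hx t).1, (heq 1 h1 t).1, Ioc_self, setIntegral_empty,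
      add_zero, integral_neg, ← sub_eq_add_neg]
    congr 1
    refine (intervalIntegral_eq_setIntegral_of_eqOn hx h1 hx.2 fun ξ hξ => ?_).symm
    rw [System.srcU_of_mem hξ, huh ξ ht]
    rfl
  · filter_upwards [hne] with t ht h x hx
    have ht0 : 0 < t := lt_of_le_of_ne h ht.symm
    have hv : ∀ ξ ∈ Icc (0 : ℝ) 1, vh ξ (S.charHat 1 t ξ) = b ξ t := fun ξ hξ => by
      change b ξ (S.charHat 1 t ξ - ψ ξ) = _
      rw [hS.charHat_one_eq hξ, add_sub_cancel_right]
    have hv1 : vh 1 t = B t := by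
      change b 1 (t - ψ 1) = _
      rw [hψ1, sub_zero, (heq 1 h1 t).2, Ioc_self, setIntegral_empty, add_zero]
    rw [hv x hx, hv1, (heq x hx t).2]
    congr 1
    refine (intervalIntegral_eq_setIntegral_of_eqOn hx h1 hx.2 fun ξ hξ => ?_).symm
    have hpos : 0 < t + ψ ξ := add_pos_of_pos_of_nonneg ht0 (hψ0 ξ hξ)
    have hmem : t ∈ {s | 0 ≤ s + ψ ξ} := hpos.le
    rw [hv ξ hξ, hS.charHat_one_eq hξ, huh ξ hpos.ne', hS.nuHat_mul_div_muHat hξ,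
      indicator_of_mem hmem, System.srcV_of_mem hξ]
  · refine Filter.Eventually.of_forall fun y hy x hx => ?_
    have hx' : x ∈ Icc (0 : ℝ) 1 := ⟨hx.1, hx.2.trans hy.2⟩
    have hchar : ∀ ξ ∈ Icc (0 : ℝ) 1, S.charHat y 0 ξ = -ψ y + ψ ξ := fun ξ hξ => by
      rw [hS.charHat_eq hξ hy]; ring
    have hv : ∀ ξ ∈ Icc (0 : ℝ) 1, vh ξ (S.charHat y 0 ξ) = b ξ (-ψ y) := fun ξ hξ => by
      change b ξ (S.charHat y 0 ξ - ψ ξ) = _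
      rw [hchar ξ hξ, add_sub_cancel_right]
    have hv1 : vh y 0 = B (-ψ y) := by
      change b y (0 - ψ y) = _
      rw [zero_sub, hstart y hy]
    rw [hv x hx', hv1, (heq x hx' _).2]
    congr 1
    have hcut : ∀ ξ ∈ Ioc x 1 \ Ioc x y, {s | 0 ≤ s + ψ ξ}.indicator
        (fun _ => S.srcV ξ (a ξ (-ψ y + ψ ξ)) (b ξ (-ψ y))) (-ψ y) = 0 := by
      intro ξ hξ
      have hyξ : y < ξ := lt_of_not_ge fun hle => hξ.2 ⟨hξ.1.1, hle⟩
      refine indicator_of_notMem ?_ _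
      have : ψ ξ < ψ y := hanti hy ⟨hy.1.trans hyξ.le, hξ.1.2⟩ hyξ
      simp only [mem_ofPred_eq, not_le]
      linarith
    -- Beyond `y` the line lies at negative times and contributes nothing. The endpoint `ξ = y` is
    -- discarded because at `t = 0` the function `uh` equals `uh0`, not `a`.
    rw [setIntegral_eq_of_subset_of_forall_sdiff_eq_zero measurableSet_Ioc
      (Ioc_subset_Ioc_right hy.2) hcut, intervalIntegral.integral_of_le hx.2,
      integral_Ioc_eq_integral_Ioo, integral_Ioc_eq_integral_Ioo]
    refine setIntegral_congr_fun measurableSet_Ioo fun ξ hξ => ?_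
    have hm : ξ ∈ Icc (0 : ℝ) 1 := ⟨hx.1.trans hξ.1.le, hξ.2.le.trans hy.2⟩
    have hlt : 0 < -ψ y + ψ ξ := by linarith [hanti hm hy hξ.2]
    have hmem : -ψ y ∈ {s | 0 ≤ s + ψ ξ} := hlt.le
    simp only [indicator_of_mem hmem]
    rw [hv ξ hm, hS.nuHat_mul_div_muHat hm, System.srcV_of_mem hm, hchar ξ hm, huh ξ hlt.ne']

end Existence

/-! ### Restriction, time shift and change of right-hand side for ODE solutions. -/

section ODE

variable {n : ℕ} {G G' : ℝ → EuclideanSpace ℝ (Fin n) → EuclideanSpace ℝ (Fin n)}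
  {z : ℝ → EuclideanSpace ℝ (Fin n)} {s s' : ℝ}

theorem IsODESolution.mono (h : IsODESolution G s z) (hs : s ≤ s') : IsODESolution G s' z := by
  intro t ht
  obtain ⟨i1, e1⟩ := h s' hs
  obtain ⟨i2, e2⟩ := h t (hs.trans ht)
  refine ⟨i1.symm.trans i2, ?_⟩
  rw [e2, ← intervalIntegral.integral_add_adjacent_intervals i1 (i1.symm.trans i2), ← add_assoc,
    ← e1]

theorem IsODESolution.comp_add_right (h : IsODESolution G s z) (c : ℝ) :
    IsODESolution (fun t => G (t + c)) (s - c) fun t => z (t + c) := by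
  intro t ht
  obtain ⟨i, e⟩ := h (t + c) (by linarith)
  refine ⟨?_, ?_⟩
  · simpa using i.comp_add_right c
  · rw [intervalIntegral.integral_comp_add_right (fun r => G r (z r)) c]
    simpa using e

theorem IsODESolution.congr (h : IsODESolution G s z)
    (he : ∀ᵐ t : ℝ, s ≤ t → G t (z t) = G' t (z t)) : IsODESolution G' s z := by
  intro t ht
  obtain ⟨i, e⟩ := h t ht
  have hres : ∀ᵐ r : ℝ, r ∈ uIoc s t → G r (z r) = G' r (z r) := by
    filter_upwards [he] with r hr hmem
    rw [uIoc_of_le ht] at hmem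
    exact hr hmem.1.le
  exact ⟨i.congr_ae ((ae_restrict_iff' measurableSet_uIoc).2 hres),
    e.trans (congrArg _ (intervalIntegral.integral_congr_ae hres))⟩

end ODE

end SemilinearObserver

/-! ### Convergence of the cascade observer. -/

theorem mainTheorem3 {n : ℕ} (S : SemilinearObserver.System n) (hS : S.Admissible)
    (h : EuclideanSpace ℝ (Fin n) → ℝ → ℝ → ℝ → EuclideanSpace ℝ (Fin n))
    (hh : S.IsFiniteTimeObserver h) :
    ∃ T : ℝ, 0 < T ∧
      ∀ (uh0 vh0 : ℝ → ℝ) (Xh0 : EuclideanSpace ℝ (Fin n)) (Y U : ℝ → ℝ),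
        MemLp uh0 ⊤ (volume.restrict (Icc (0 : ℝ) 1)) →
        MemLp vh0 ⊤ (volume.restrict (Icc (0 : ℝ) 1)) →
        MemLp Y ⊤ (volume.restrict (Ici (0 : ℝ))) →
        MemLp U ⊤ (volume.restrict (Ici (0 : ℝ))) →
        -- the PDE part of the observer has a solution
        (∃ uh vh : ℝ → ℝ → ℝ, S.IsPDEObserver Y U uh0 vh0 uh vh) ∧
        -- for every solution of the plant with input `U` and output `Y`
        ∀ (u0 v0 : ℝ → ℝ) (X0 : EuclideanSpace ℝ (Fin n)) (u v : ℝ → ℝ → ℝ)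
          (X : ℝ → EuclideanSpace ℝ (Fin n)),
          MemLp u0 ⊤ (volume.restrict (Icc (0 : ℝ) 1)) →
          MemLp v0 ⊤ (volume.restrict (Icc (0 : ℝ) 1)) →
          S.IsBroadSolution U u0 v0 X0 u v X →
          (∀ᵐ t : ℝ, 0 ≤ t → Y t = u 1 t) →
          -- and for every solution of the observer
          ∀ uh vh : ℝ → ℝ → ℝ, S.IsPDEObserver Y U uh0 vh0 uh vh →
            (∀ᵐ t : ℝ, T ≤ t → ∀ᵐ x : ℝ, x ∈ Icc (0 : ℝ) 1 →
              uh x t = u x (S.tauCheck t x) ∧ vh x t = v x (S.tauCheck t x)) ∧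
            (∀ x ∈ Icc (0 : ℝ) 1, ∀ᵐ t : ℝ, T ≤ t →
              uh x t = u x (S.tauCheck t x) ∧ vh x t = v x (S.tauCheck t x)) ∧
            ∀ Xh : ℝ → EuclideanSpace ℝ (Fin n), S.IsODEObserver h Xh0 uh vh Xh →
              ∀ t : ℝ, T ≤ t → Xh t = X (S.tauCheck t 0) := by
  obtain ⟨Th, hTh, hobs⟩ := hh
  have h0 : (0 : ℝ) ∈ Icc (0 : ℝ) 1 := left_mem_Icc.2 zero_le_one
  obtain ⟨K, hF, hG⟩ := hS.exists_isLipSource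
  have hsl := hS.isSlowness_muHat
  have hT0 : 0 ≤ S.timeU 0 := hS.isSlowness_lamU.tailTime_nonneg h0
  have hψ0 : 0 ≤ S.timeHat 0 := hsl.tailTime_nonneg h0
  -- The past state exists from `timeU 0`, is determined by the data at `x = 1` after another
  -- `timeHat 0`, and the ODE observer then needs `Th`.
  refine ⟨S.timeU 0 + S.timeHat 0 + Th, by linarith, ?_⟩
  intro uh0 vh0 Xh0 Y U _ hvh0 hY hU
  obtain ⟨uh', vh', hobs', hvm, C, hC⟩ := hS.exists_isPDEObserver (uh0 := uh0) hvh0 hY hU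
  refine ⟨⟨uh', vh', hobs'⟩, ?_⟩
  intro u0 v0 X0 u v X _ _ hsol hYu uh vh hw
  have hplant := hsol.isMarching hS hYu
  have huniq : ∀ {uh vh : ℝ → ℝ → ℝ}, S.IsPDEObserver Y U uh0 vh0 uh vh → _ := fun hw =>
    (hw.isMarching hS hT0).unique (ψ := S.timeHat) hF hG hsl.continuous_tailTime.measurable
      hsl.strictAntiOn_tailTime.antitoneOn (SemilinearObserver.tailTime_one _) hplant
  obtain ⟨hae, hfix⟩ := huniq hw
  refine ⟨?_, fun x hx => ?_, ?_⟩
  · filter_upwards [hae] with t ht hT using ht (by linarith)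
  · filter_upwards [hfix x hx] with t ht hT using ht (by linarith)
  intro Xh hXh t ht
  have hshift : ∀ {p : ℝ → Prop}, (∀ᵐ t : ℝ, p t) → ∀ᵐ s : ℝ, p (s + S.timeU 0) := fun hp =>
    (measurePreserving_add_right volume (S.timeU 0)).quasiMeasurePreserving.ae hp
  have htau : ∀ s, S.tauCheck (s + S.timeU 0) 0 = s := fun s => by
    rw [hS.tauCheck_eq h0, add_sub_cancel_right]
  -- The finite-time observer needs an input in `L^∞` up to infinity, while plant solutions are only
  -- locally bounded. Uniqueness identifies the trace with that of the constructed observer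
  -- solution, which is globally bounded.
  have hv : MemLp (v 0) ⊤ (volume.restrict (Ici (S.timeHat 0))) := by
    have hb : MemLp (fun s => vh' 0 (s + S.timeU 0)) ⊤
        (volume.restrict (Ici (S.timeHat 0))) :=
      memLp_top_of_bound (hvm.comp (measurable_add_const _)).aestronglyMeasurable C
        (Filter.Eventually.of_forall fun s => hC _)
    refine hb.ae_eq ((ae_restrict_iff' measurableSet_Ici).2 ?_)
    filter_upwards [hshift ((huniq hobs').2 0 h0)] with s hs hmem
    rw [(hs (by linarith [mem_Ici.1 hmem])).2, htau]
  -- On the plant clock the delayed estimate is driven by the true `u(0, ·)` and `v(0, ·)`, and the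
  -- boundary condition rewrites `u(0, ·)` as the output `g0`.
  have hXhs : SemilinearObserver.IsODESolution (fun t z => h z (S.g0 (X t) (v 0 t) t) (v 0 t) t) (S.timeHat 0)
      fun s => Xh (s + S.timeU 0) := by
    have h1 := (hXh.1.mono (add_nonneg hψ0 hT0)).comp_add_right (S.timeU 0)
    rw [add_sub_cancel_right] at h1
    refine h1.congr ?_
    filter_upwards [hshift (hfix 0 h0), hsol.bc_u] with s hs hbc hle
    obtain ⟨e1, e2⟩ := hs (by linarith)
    simp only [e1, e2, htau, hbc (hψ0.trans hle)]
  have hfin := hobs (S.timeHat 0) hψ0 (v 0) hv X (fun s => Xh (s + S.timeU 0))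
    (hsol.ode.mono hψ0) hXhs (t - S.timeU 0) (by linarith)
  rw [hS.tauCheck_eq h0, ← hfin, sub_add_cancel]
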